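/- Let $K$ be a field. For a numerical semigroup $H$ (a submonoid of $\mathbb{N}=\{0,1,2,\dots\}$ with finite complement) let $K[[H]]\subseteq K[[t]]$ be the ring of power series all of whose exponents lie in $H$. For a one-dimensional Cohen–Macaulay local ring $R$ with canonical module $\omega_R$ let $\mathrm{tr}_R(\omega_R)=\sum_{f\in \mathrm{Hom}_R(\omega_R,R)}\mathrm{Im}\, f$, and let $$bg(R)=\inf\{\ell_S(R/S) : S\subseteq R \text{ is a Gorenstein subring},\ \mathrm{Q}(S)=\mathrm{Q}(R),\ R \text{ is a finitely generated } S\text{-module}\},$$ where $\ell$ denotes length and $\mathrm{Q}(\cdot)$ the total ring of fractions (an extension $S\subseteq R$ satisfying the last two conditions is called birational). (1) Let $\ell\ge 0$ be an integer, let $$H=\langle m : 6\ell+10\le m\le 9\ell+14,\ \text{or } m=9\ell+17+3s \text{ for some } 0\le s\le 3\ell\rangle,\qquad H'=\langle m : 6\ell+10\le m\le 9\ell+14\rangle\subseteq H,$$ and let $R=K[[H]]$. Then $H$ is a numerical semigroup, $R$ is a one-dimensional Cohen–Macaulay local ring that is not Gorenstein, and $R$ has a canonical module. The numerical semigroup $H'$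 is symmetric, that is, with $F$ the largest integer not in $H'$, for every $x\in\mathbb{Z}$ exactly one of $x$ and $F-x$ lies in $H'$. The ring $K[[H']]$ is Gorenstein, $K[[H']]\subseteq R$ is a birational extension, and $\ell_{K[[H']]}(R/K[[H']])=\ell+2$. Moreover $$bg(R)=\ell+2\qquad\text{and}\qquad \ell_R(R/\mathrm{tr}_R(\omega_R))=2\ell+3=2\,bg(R)-1>bg(R).$$ (2) Consequently, for every integer $b\ge 2$ there is a numerical semigroup $H$ such that, for $R=K[[H]]$, one has $bg(R)=b$ and $\ell_R(R/\mathrm{tr}_R(\omega_R))=2b-1>b$. That is, equality is attained in the inequality $\ell_R(R/\mathrm{tr}_R(\omega_R))\le 2\,bg(R)-1$, and the inequality $\ell_R(R/\mathrm{tr}_R(\omega_R))\le bg(R)$ fails, for a numerical semigroup ring with $bg(R)=b$. -/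

import Mathlib

open CategoryTheory CategoryTheory.Abelian

universe u

/-! ## Numerical semigroups -/

/-- A submonoid of `ℕ` is a numerical semigroup if its complement in `ℕ` is finite. -/
def IsNumericalSemigroup (H : AddSubmonoid ℕ) : Prop :=
  {n : ℕ | n ∉ H}.Finite

/-- `F` is the Frobenius number of `H`: the largest integer that does not belong to `H`. -/
def IsFrobeniusNumber (H : AddSubmonoid ℕ) (F : ℤ) : Prop :=
  IsGreatest {x : ℤ | ¬ ∃ h ∈ H, (h : ℤ) = x} F

/-- A numerical semigroup with Frobenius number `F` is symmetric if for every integer `x`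
exactly one of `x` and `F - x` belongs to it. -/
def IsSymmetricSemigroup (H : AddSubmonoid ℕ) : Prop :=
  IsNumericalSemigroup H ∧ ∃ F : ℤ, IsFrobeniusNumber H F ∧
    ∀ x : ℤ, (∃ h ∈ H, (h : ℤ) = x) ↔ ¬ ∃ h ∈ H, (h : ℤ) = F - x

/-- The semigroup `⟨m : 6ℓ+10 ≤ m ≤ 9ℓ+14⟩`. -/
def semigroupH' (l : ℕ) : AddSubmonoid ℕ :=
  AddSubmonoid.closure {m | 6 * l + 10 ≤ m ∧ m ≤ 9 * l + 14}

/-- The semigroup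
`⟨m : 6ℓ+10 ≤ m ≤ 9ℓ+14, or m = 9ℓ+17+3s for some 0 ≤ s ≤ 3ℓ⟩`. -/
def semigroupH (l : ℕ) : AddSubmonoid ℕ :=
  AddSubmonoid.closure
    {m | (6 * l + 10 ≤ m ∧ m ≤ 9 * l + 14) ∨ ∃ s ≤ 3 * l, m = 9 * l + 17 + 3 * s}

/-! ## The complete semigroup ring `K[[H]]` -/

/-- `K[[H]]`: the power series over `K` all of whose exponents lie in `H`. -/
def semigroupRing (K : Type u) [Field K] (H : AddSubmonoid ℕ) :
    Subalgebra K (PowerSeries K) where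
  carrier := {f | ∀ n, n ∉ H → PowerSeries.coeff n f = 0}
  add_mem' := by
    intro f g hf hg n hn
    simp [hf n hn, hg n hn]
  mul_mem' := by
    intro f g hf hg n hn
    rw [PowerSeries.coeff_mul]
    refine Finset.sum_eq_zero fun p hp => ?_
    rw [Finset.HasAntidiagonal.mem_antidiagonal] at hp
    by_cases h1 : p.1 ∈ H
    · have h2 : p.2 ∉ H := fun h2 => hn (hp ▸ H.add_mem h1 h2)
      rw [hg _ h2, mul_zero]
    · rw [hf _ h1, zero_mul]
  algebraMap_mem' := by
    intro r n hn
    have h0 : n ≠ 0 := fun h => hn (h ▸ H.zero_mem)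
    simp [PowerSeries.coeff_C, h0]

theorem mem_semigroupRing {K : Type u} [Field K] {H : AddSubmonoid ℕ} {f : PowerSeries K} :
    f ∈ semigroupRing K H ↔ ∀ n, n ∉ H → PowerSeries.coeff n f = 0 :=
  Iff.rfl

theorem inv_mem_semigroupRing {K : Type u} [Field K] {H : AddSubmonoid ℕ} {f : PowerSeries K}
    (hf : f ∈ semigroupRing K H) : f⁻¹ ∈ semigroupRing K H := by
  intro n
  induction n using Nat.strong_induction_on with
  | _ n ih =>
    intro hn
    have h0 : n ≠ 0 := fun h => hn (h ▸ H.zero_mem)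
    rw [PowerSeries.coeff_inv, if_neg h0]
    rw [Finset.sum_eq_zero, mul_zero]
    intro p hp
    rw [Finset.HasAntidiagonal.mem_antidiagonal] at hp
    split_ifs with hlt
    · by_cases h1 : p.1 ∈ H
      · have h2 : p.2 ∉ H := fun h2 => hn (hp ▸ H.add_mem h1 h2)
        rw [ih _ hlt h2, mul_zero]
      · rw [hf _ h1, zero_mul]
    · rfl

instance semigroupRing_isLocalRing (K : Type u) [Field K] (H : AddSubmonoid ℕ) :
    IsLocalRing (semigroupRing K H) := by
  have key : ∀ a : semigroupRing K H,
      PowerSeries.constantCoeff (a : PowerSeries K) ≠ 0 → IsUnit a := by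
    intro a ha
    refine IsUnit.of_mul_eq_one ⟨_, inv_mem_semigroupRing a.2⟩ ?_
    exact Subtype.ext (PowerSeries.mul_inv_cancel _ ha)
  refine IsLocalRing.of_isUnit_or_isUnit_one_sub_self fun a => ?_
  by_cases ha : PowerSeries.constantCoeff (a : PowerSeries K) = 0
  · right
    apply key
    simp [ha]
  · exact Or.inl (key a ha)

/-! ## Gorenstein rings, canonical modules, trace ideals -/

/-- `M` has finite injective dimension over `R`. -/
def HasFiniteInjectiveDimension (R : Type u) [CommRing R] (M : Type u) [AddCommGroup M]
    [Module R M] : Prop :=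
  ∃ n : ℕ, HasInjectiveDimensionLE (ModuleCat.of R M) n

/-- A Gorenstein ring: a Noetherian ring whose localization at every maximal ideal has finite
injective dimension as a module over itself. -/
def IsGorensteinRing (R : Type u) [CommRing R] : Prop :=
  IsNoetherianRing R ∧ ∀ (m : Ideal R) [m.IsMaximal],
    HasFiniteInjectiveDimension (Localization.AtPrime m) (Localization.AtPrime m)

/-- For a Noetherian local ring `R` with residue field `k`: a maximal Cohen–Macaulay module is a
nonzero finitely generated module `M` of depth `dim R`, where
`depth M = inf {i : Ext^i_R(k, M) ≠ 0}`. -/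
structure IsMaximalCohenMacaulay (R : Type u) [CommRing R] [IsLocalRing R] (M : Type u)
    [AddCommGroup M] [Module R M] : Prop where
  nontrivial : Nontrivial M
  finite : Module.Finite R M
  ext_eq_zero : ∀ i : ℕ, (i : WithBot ℕ∞) < ringKrullDim R →
    Subsingleton (Ext (ModuleCat.of R (IsLocalRing.ResidueField R)) (ModuleCat.of R M) i)

/-- A Cohen–Macaulay local ring. -/
def IsCohenMacaulayLocalRing (R : Type u) [CommRing R] [IsLocalRing R] : Prop :=
  IsNoetherianRing R ∧ IsMaximalCohenMacaulay R R

/-- A canonical module of a Cohen–Macaulay local ring `R` with residue field `k`: a maximal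
Cohen–Macaulay module of type `1`, i.e. `Ext^d_R(k, M)` has length `1` for `d = dim R`, and of
finite injective dimension. -/
structure IsCanonicalModule (R : Type u) [CommRing R] [IsLocalRing R] (M : Type u)
    [AddCommGroup M] [Module R M] : Prop where
  isMaximalCohenMacaulay : IsMaximalCohenMacaulay R M
  type_eq_one : ∃ d : ℕ, ringKrullDim R = d ∧ Module.length R
    (Ext (ModuleCat.of R (IsLocalRing.ResidueField R)) (ModuleCat.of R M) d) = 1
  finite_injectiveDimension : HasFiniteInjectiveDimension R M

/-- The trace ideal `tr_R(M) = ∑ im f`, the sum over all `f ∈ Hom_R(M, R)`. -/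
def moduleTrace (R : Type u) [CommRing R] (M : Type u) [AddCommGroup M] [Module R M] :
    Ideal R :=
  ⨆ f : M →ₗ[R] R, LinearMap.range f

/-! ## The birational Gorenstein colength -/

/-- The extension `S ⊆ R` is birational: the total ring of fractions `Q(R)` is also the total ring
of fractions of `S` (via `S ⊆ R ⊆ Q(R)`), and `R` is a finitely generated `S`-module. -/
def IsBirationalSubring {R : Type u} [CommRing R] (S : Subring R) : Prop :=
  IsFractionRing S (FractionRing R) ∧ Module.Finite S R

/-- `ℓ_S(R/S)`, the length of the `S`-module `R/S`. -/
noncomputable def subringColength {R : Type u} [CommRing R] (S : Subring R) : ℕ∞ :=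
  Module.length S (R ⧸ LinearMap.range (Algebra.linearMap S R))

/-- The birational Gorenstein colength `bg(R)`: the infimum of `ℓ_S(R/S)` over all Gorenstein
subrings `S` of `R` such that `S ⊆ R` is birational (`⊤` if there is none). -/
noncomputable def birationalGorensteinColength (R : Type u) [CommRing R] : ℕ∞ :=
  sInf {n : ℕ∞ | ∃ S : Subring R, IsGorensteinRing S ∧ IsBirationalSubring S ∧
    subringColength S = n}

/-- `K[[H']] ∩ K[[H]]` as a subring of `K[[H]]`; for `H' ⊆ H` this is `K[[H']]`. -/
noncomputable def semigroupSubring (K : Type u) [Field K] (H' H : AddSubmonoid ℕ) :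
    Subring (semigroupRing K H) :=
  (semigroupRing K H').toSubring.comap (semigroupRing K H).val.toRingHom

/-! Lower bound for `bg(R)`. Let `A ⊆ R` be Gorenstein and birational. Then `A` is local, and its
conductor `𝔠 = A : R` is `Hom_A(R, A)`, a copy of `ω_R` inside `R`; so `𝔠 ⊆ tr(ω_R)`. Moreover `A/𝔠
= (A : A)/(A : R)` embeds in `Ext¹_A(R/A, A)`, whose length is at most `ℓ_A(R/A)` because `Ext¹_A(k,
A)` has length one. Hence `ℓ_R(R/tr ω) ≤ ℓ_A(R/𝔠) ≤ 2 ℓ_A(R/A)` (`length_quotient_moduleTrace_le`).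
For the family the left side is the odd number `2ℓ+3`, which forces `ℓ_A(R/A) ≥ ℓ+2`, and `K[[H']]`
attains this value, since `H \ H'` has `ℓ+2` elements and `H'` is symmetric with Frobenius number
`18ℓ+29`.

The trace is a monomial computation. With `F = 12ℓ+19` the Frobenius number of `H`, the fractional
ideal `ω` spanned by the exponents `i` with `F - i ∉ H` contains `1`, so every map `ω → R` is
multiplication by a power series `p`. The exponents allowed in `p` are `6ℓ+10` and everything from
`12ℓ+20` on; adding the exponents of `ω` gives those of the trace, and exactly `2ℓ+3` elements of
`H` are missed.

Canonical modules are defined homologically, so they have to be identified with this `ω`. Existence: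
`0 → ω → K((t)) → K((t))/ω → 0` is an injective resolution, the last term being the continuous
`K`-dual of `R`. Uniqueness: a maximal Cohen–Macaulay module of type one has rank one, by comparing
`ℓ(M/xM)` with `ℓ(R/xR)`, hence embeds in `K[[t]]`. For the pairing `(f, g) ↦ coeff n (f * g)` the
orthogonal `I` of the image `M` satisfies `(𝔪I)^⊥ = M : 𝔪`; type one makes `I/𝔪I` one-dimensional,
so `I` is principal by Nakayama, and dualizing back gives `M = vω`
(`exists_eq_mul_canonicalSubmodule`).

The same criterion is applied to the conductor of `A`; in both cases its type hypothesis comes from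
`exists_sub_smul_mem_of_length_ext_le_one`. Everything is proved for the predicate
`IsSemigroupRing`, so that it applies both to `K[[H]]` and to the copy of `K[[H']]` inside it. -/

/-! ## The long exact sequence of `Ext` for modules -/

section ExtSequence

variable {A : Type u} [CommRing A] {N' N N'' : Type u} [AddCommGroup N'] [AddCommGroup N]
  [AddCommGroup N''] [Module A N'] [Module A N] [Module A N'']
  (M : Type u) [AddCommGroup M] [Module A M]

/-- `Ext` of modules, as a module. -/
abbrev ModuleExt (A : Type u) [CommRing A] (N M : Type u) [AddCommGroup N] [Module A N]
    [AddCommGroup M] [Module A M] (i : ℕ) : Type u :=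
  Ext (ModuleCat.of A N) (ModuleCat.of A M) i

/-- The map induced on `Ext` by a linear map in the first variable. -/
noncomputable def ModuleExt.precomp (f : N' →ₗ[A] N) (i : ℕ) :
    ModuleExt A N M i →ₗ[A] ModuleExt A N' M i :=
  Ext.precompOfLinear (Ext.mk₀ (ModuleCat.ofHom f)) A (ModuleCat.of A M) (zero_add i)

theorem exact_shortExact {f : N' →ₗ[A] N} {g : N →ₗ[A] N''} (hf : Function.Injective f)
    (hg : Function.Surjective g) (h : Function.Exact f g) :
    (ModuleCat.shortComplexOfCompEqZero f g h.linearMap_comp_eq_zero).ShortExact :=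
  ModuleCat.shortComplex_shortExact _ h hf hg

/-- The connecting map of the long exact sequence of `Ext` in the first variable. -/
noncomputable def ModuleExt.connecting {f : N' →ₗ[A] N} {g : N →ₗ[A] N''}
    (hf : Function.Injective f) (hg : Function.Surjective g) (h : Function.Exact f g) (i : ℕ) :
    ModuleExt A N' M i →ₗ[A] ModuleExt A N'' M (i + 1) :=
  Ext.precompOfLinear (exact_shortExact hf hg h).extClass A (ModuleCat.of A M) (add_comm 1 i)

variable {f : N' →ₗ[A] N} {g : N →ₗ[A] N''}
    (hf : Function.Injective f) (hg : Function.Surjective g) (h : Function.Exact f g) (i : ℕ)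

theorem ModuleExt.exact_precomp_precomp {f : N' →ₗ[A] N} {g : N →ₗ[A] N''}
    (hf : Function.Injective f) (hg : Function.Surjective g) (h : Function.Exact f g) (i : ℕ) :
    Function.Exact (ModuleExt.precomp M g i) (ModuleExt.precomp M f i) := by
  intro x
  constructor
  · intro hx
    exact Ext.contravariant_sequence_exact₂ (exact_shortExact hf hg h) _ x hx
  · rintro ⟨y, rfl⟩
    change (Ext.mk₀ (ModuleCat.ofHom f)).comp ((Ext.mk₀ (ModuleCat.ofHom g)).comp y (zero_add i))
      (zero_add i) = 0
    rw [Ext.mk₀_comp_mk₀_assoc, ← ModuleCat.ofHom_comp, h.linearMap_comp_eq_zero]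
    simp

theorem ModuleExt.exact_precomp_connecting :
    Function.Exact (ModuleExt.precomp M f i) (ModuleExt.connecting M hf hg h i) := by
  intro x
  constructor
  · intro hx
    exact Ext.contravariant_sequence_exact₁ (exact_shortExact hf hg h) _ x (add_comm 1 i) hx
  · rintro ⟨y, rfl⟩
    exact ShortComplex.ShortExact.extClass_comp_assoc (exact_shortExact hf hg h) y
      (h := add_comm 1 i)

theorem ModuleExt.exact_connecting_precomp :
    Function.Exact (ModuleExt.connecting M hf hg h i) (ModuleExt.precomp M g (i + 1)) := by
  intro x
  constructor
  · intro hx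
    exact Ext.contravariant_sequence_exact₃ (exact_shortExact hf hg h) _ x hx (add_comm 1 i)
  · rintro ⟨y, rfl⟩
    exact ShortComplex.ShortExact.comp_extClass_assoc (exact_shortExact hf hg h) y (add_comm 1 i)

/-- `Ext⁰` is the module of homomorphisms. -/
noncomputable def ModuleExt.zeroEquiv (N : Type u) [AddCommGroup N] [Module A N] :
    ModuleExt A N M 0 ≃ₗ[A] (N →ₗ[A] M) :=
  (Ext.linearEquiv₀ (R := A)).trans (ModuleCat.homLinearEquiv (S := A))

theorem ModuleExt.zeroEquiv_precomp (f : N' →ₗ[A] N) (x : ModuleExt A N M 0) :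
    ModuleExt.zeroEquiv M N' (ModuleExt.precomp M f 0 x) =
      (ModuleExt.zeroEquiv M N x).comp f := by
  obtain ⟨y, rfl⟩ := (Ext.linearEquiv₀ (R := A)).symm.surjective x
  change ModuleCat.homLinearEquiv (S := A) (Ext.linearEquiv₀ (R := A)
    ((Ext.mk₀ (ModuleCat.ofHom f)).comp (Ext.mk₀ y) (zero_add 0))) = _
  rw [Ext.mk₀_comp_mk₀]
  have (X Y : ModuleCat.{u} A) (k : X ⟶ Y) : Ext.linearEquiv₀ (R := A) (Ext.mk₀ k) = k :=
    (Ext.linearEquiv₀ (R := A)).apply_symm_apply k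
  change _ = (ModuleCat.homLinearEquiv (S := A) (Ext.linearEquiv₀ (R := A) (Ext.mk₀ y))).comp f
  rw [this, this]
  rfl

/-- The connecting map from homomorphisms to `Ext¹`. -/
noncomputable def ModuleExt.homConnecting : (N' →ₗ[A] M) →ₗ[A] ModuleExt A N'' M 1 :=
  (ModuleExt.connecting M hf hg h 0).comp (ModuleExt.zeroEquiv M N').symm.toLinearMap

theorem ModuleExt.homConnecting_eq_zero_iff (φ : N' →ₗ[A] M) :
    ModuleExt.homConnecting M hf hg h φ = 0 ↔ ∃ ψ : N →ₗ[A] M, ψ.comp f = φ := by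
  rw [ModuleExt.homConnecting, LinearMap.comp_apply,
    (ModuleExt.exact_precomp_connecting M hf hg h 0) _]
  constructor
  · rintro ⟨y, hy⟩
    refine ⟨ModuleExt.zeroEquiv M N y, ?_⟩
    rw [← ModuleExt.zeroEquiv_precomp, hy]
    simp
  · rintro ⟨ψ, rfl⟩
    refine ⟨(ModuleExt.zeroEquiv M N).symm ψ, ?_⟩
    apply (ModuleExt.zeroEquiv M N').injective
    rw [ModuleExt.zeroEquiv_precomp]
    simp

theorem ModuleExt.homConnecting_surjective [Module.Projective A N] :
    Function.Surjective (ModuleExt.homConnecting M hf hg h) := by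
  intro x
  obtain ⟨y, hy⟩ := ((ModuleExt.exact_connecting_precomp M hf hg h 0) x).1
    (Ext.eq_zero_of_projective _)
  exact ⟨ModuleExt.zeroEquiv M N' y, by simpa [ModuleExt.homConnecting] using hy⟩

/-- `Ext` is invariant under isomorphism in the first variable. -/
noncomputable def ModuleExt.congr (e : N' ≃ₗ[A] N) (i : ℕ) :
    ModuleExt A N M i ≃ₗ[A] ModuleExt A N' M i :=
  have key {X Y : Type u} [AddCommGroup X] [AddCommGroup Y] [Module A X] [Module A Y]
      (e : X ≃ₗ[A] Y) (x : ModuleExt A Y M i) :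
      ModuleExt.precomp M e.symm.toLinearMap i (ModuleExt.precomp M e.toLinearMap i x) = x := by
    change (Ext.mk₀ (ModuleCat.ofHom _)).comp ((Ext.mk₀ (ModuleCat.ofHom _)).comp x (zero_add i))
      (zero_add i) = x
    rw [Ext.mk₀_comp_mk₀_assoc, ← ModuleCat.ofHom_comp]
    simp
  LinearEquiv.ofLinearMap (ModuleExt.precomp M e.toLinearMap i)
    (ModuleExt.precomp M e.symm.toLinearMap i)
    (LinearMap.ext fun x => key e.symm x) (LinearMap.ext fun x => key e x)

end ExtSequence

/-! ## Lengths -/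

theorem Module.length_le_add_of_exact {A N M P : Type*} [Ring A] [AddCommGroup N]
    [AddCommGroup M] [AddCommGroup P] [Module A N] [Module A M] [Module A P] {f : N →ₗ[A] M}
    {g : M →ₗ[A] P} (h : Function.Exact f g) :
    Module.length A M ≤ Module.length A N + Module.length A P := by
  rw [Module.length_eq_add_of_exact (LinearMap.ker g).subtype g.rangeRestrict
    (Submodule.subtype_injective _) g.surjective_rangeRestrict (by
      rw [LinearMap.exact_iff]; simp)]
  refine add_le_add ?_ (Module.length_le_of_injective _ (Submodule.subtype_injective _))
  rw [h.linearMap_ker_eq]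
  exact Module.length_le_of_surjective f.rangeRestrict f.surjective_rangeRestrict

theorem IsSimpleModule.nonempty_equiv_residueField {A N : Type*} [CommRing A] [IsLocalRing A]
    [AddCommGroup N] [Module A N] [IsSimpleModule A N] :
    Nonempty (N ≃ₗ[A] IsLocalRing.ResidueField A) := by
  obtain ⟨m, hm, ⟨e⟩⟩ := isSimpleModule_iff_quot_maximal.mp ‹IsSimpleModule A N›
  obtain rfl := IsLocalRing.eq_maximalIdeal hm
  exact ⟨e⟩

section ExtLength

variable {A : Type u} [CommRing A] [IsLocalRing A] (M : Type u) [AddCommGroup M] [Module A M]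

/-- Dévissage along a composition series: each simple factor is the residue field, and the long
exact sequence makes the length of `Ext` subadditive. -/
theorem ModuleExt.length_le {N : Type u} [AddCommGroup N] [Module A N] (hN : IsFiniteLength A N)
    (i : ℕ) : Module.length A (ModuleExt A N M i) ≤
      Module.length A N * Module.length A (ModuleExt A (IsLocalRing.ResidueField A) M i) := by
  induction hN with
  | @of_subsingleton N _ _ _ =>
    have : Subsingleton (ModuleExt A N M i) := by
      refine subsingleton_of_forall_eq 0 fun x => ?_
      have : Limits.IsZero (ModuleCat.of A N) := ModuleCat.isZero_of_subsingleton _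
      have h := Ext.mk₀_id_comp x
      rw [this.eq_of_src (𝟙 _) 0] at h
      simpa using h.symm
    simp
  | @of_simple_quotient N _ _ N₀ _ _ ih =>
    have hex : Function.Exact N₀.subtype N₀.mkQ := LinearMap.exact_subtype_mkQ N₀
    have h1 := Module.length_eq_add_of_exact N₀.subtype N₀.mkQ N₀.subtype_injective
      N₀.mkQ_surjective hex
    obtain ⟨e⟩ := IsSimpleModule.nonempty_equiv_residueField (A := A) (N := N ⧸ N₀)
    have h2 := Module.length_le_add_of_exact (ModuleExt.exact_precomp_precomp M
      N₀.subtype_injective N₀.mkQ_surjective hex i)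
    rw [← (ModuleExt.congr M e i).length_eq] at h2
    rw [h1, Module.length_eq_one A (N ⧸ N₀), add_mul, one_mul, add_comm]
    exact h2.trans (by gcongr)

theorem ModuleExt.subsingleton_of_isFiniteLength {i : ℕ}
    (hk : Subsingleton (ModuleExt A (IsLocalRing.ResidueField A) M i)) {N : Type u}
    [AddCommGroup N] [Module A N] (hN : IsFiniteLength A N) :
    Subsingleton (ModuleExt A N M i) := by
  have := ModuleExt.length_le M hN i
  rw [Module.length_eq_zero (M := ModuleExt A (IsLocalRing.ResidueField A) M i), mul_zero] at this
  exact Module.length_eq_zero_iff.mp (le_antisymm this bot_le)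

/-- The two vanishing hypotheses propagate to all modules of finite length, so the dévissage
sequences in degree `i + 1` become short exact and lengths add up exactly. -/
theorem ModuleExt.length_eq {i : ℕ}
    (h₀ : Subsingleton (ModuleExt A (IsLocalRing.ResidueField A) M i))
    (h₂ : Subsingleton (ModuleExt A (IsLocalRing.ResidueField A) M (i + 1 + 1))) {N : Type u}
    [AddCommGroup N] [Module A N] (hN : IsFiniteLength A N) :
    Module.length A (ModuleExt A N M (i + 1)) =
      Module.length A N * Module.length A (ModuleExt A (IsLocalRing.ResidueField A) M (i + 1)) := by
  induction hN with
  | @of_subsingleton N _ _ _ =>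
    have := ModuleExt.length_le M (.of_subsingleton : IsFiniteLength A N) (i + 1)
    rw [Module.length_eq_zero (M := N), zero_mul] at this ⊢
    exact le_antisymm this bot_le
  | @of_simple_quotient N _ _ N₀ _ hN₀ ih =>
    have hex : Function.Exact N₀.subtype N₀.mkQ := LinearMap.exact_subtype_mkQ N₀
    have h1 := Module.length_eq_add_of_exact N₀.subtype N₀.mkQ N₀.subtype_injective
      N₀.mkQ_surjective hex
    obtain ⟨e⟩ := IsSimpleModule.nonempty_equiv_residueField (A := A) (N := N ⧸ N₀)
    have s0 := ModuleExt.subsingleton_of_isFiniteLength M h₀ hN₀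
    have s2 : Subsingleton (ModuleExt A (N ⧸ N₀) M (i + 1 + 1)) :=
      (ModuleExt.congr M e (i + 1 + 1)).symm.toEquiv.subsingleton
    have h2 := Module.length_eq_add_of_exact (ModuleExt.precomp M N₀.mkQ (i + 1))
      (ModuleExt.precomp M N₀.subtype (i + 1))
      (by
        rw [injective_iff_map_eq_zero]
        intro x hx
        obtain ⟨y, rfl⟩ := (ModuleExt.exact_connecting_precomp M N₀.subtype_injective
          N₀.mkQ_surjective hex i x).1 hx
        rw [Subsingleton.elim y 0, map_zero])
      (fun x => (ModuleExt.exact_precomp_connecting M N₀.subtype_injective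
          N₀.mkQ_surjective hex (i + 1) x).1 (Subsingleton.elim _ _))
      (ModuleExt.exact_precomp_precomp M N₀.subtype_injective N₀.mkQ_surjective hex (i + 1))
    rw [h2, h1, ih, ← (ModuleExt.congr M e (i + 1)).length_eq, Module.length_eq_one A (N ⧸ N₀),
      add_mul, one_mul, add_comm]

end ExtLength

/-! ### `Ext` of `A/x` for a nonzerodivisor `x` -/

section RegularElement

variable {A : Type u} [CommRing A] (M : Type u) [AddCommGroup M] [Module A M]

theorem lsmul_injective_of_mem_nonZeroDivisors {x : A} (hx : x ∈ nonZeroDivisors A) :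
    Function.Injective (LinearMap.lsmul A A x) := by
  rw [injective_iff_map_eq_zero]
  intro y hy
  exact (mul_left_mem_nonZeroDivisors_eq_zero_iff hx).mp hy

theorem exact_lsmul_mkQ (x : A) :
    Function.Exact (LinearMap.lsmul A A x) (Ideal.span {x} : Ideal A).mkQ := by
  intro y
  rw [Submodule.mkQ_apply, Submodule.Quotient.mk_eq_zero, Ideal.mem_span_singleton']
  constructor
  · rintro ⟨a, rfl⟩; exact ⟨a, by simp [mul_comm]⟩
  · rintro ⟨a, rfl⟩; exact ⟨a, by simp [mul_comm]⟩

/-- Applying `Hom(-, M)` to `0 → A → A → A/x → 0` identifies `Ext¹(A/x, M)` with `M/xM`. -/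
theorem ModuleExt.length_quotient_smul_eq {x : A} (hx : x ∈ nonZeroDivisors A) :
    Module.length A (ModuleExt A (A ⧸ Ideal.span {x}) M 1) =
      Module.length A (M ⧸ LinearMap.range (LinearMap.lsmul A M x)) := by
  have hinj := lsmul_injective_of_mem_nonZeroDivisors hx
  have hex := exact_lsmul_mkQ x
  let δ := ModuleExt.homConnecting M hinj (Submodule.mkQ_surjective _) hex
  let e := (LinearMap.ringLmapEquivSelf A A M).symm
  have hs : Function.Surjective (δ ∘ₗ e.toLinearMap) :=
    (ModuleExt.homConnecting_surjective M hinj (Submodule.mkQ_surjective _) hex).comp e.surjective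
  have hk : LinearMap.ker (δ ∘ₗ e.toLinearMap) = LinearMap.range (LinearMap.lsmul A M x) := by
    ext m
    rw [LinearMap.mem_ker, LinearMap.comp_apply, ModuleExt.homConnecting_eq_zero_iff]
    constructor
    · rintro ⟨ψ, hψ⟩
      refine ⟨ψ 1, ?_⟩
      have := LinearMap.congr_fun hψ 1
      rw [← (by simpa [e] using this : ψ x = m)]
      simp [← map_smul]
    · rintro ⟨y, rfl⟩
      refine ⟨e y, ?_⟩
      ext
      simp [e]
  rw [← ((δ ∘ₗ e.toLinearMap).quotKerEquivOfSurjective hs).length_eq, hk]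

/-- The quotient `A/x` has a free resolution of length one. -/
theorem ModuleExt.subsingleton_quotient_span {x : A} (hx : x ∈ nonZeroDivisors A) (i : ℕ) :
    Subsingleton (ModuleExt A (A ⧸ Ideal.span {x}) M (i + 1 + 1)) := by
  have hinj := lsmul_injective_of_mem_nonZeroDivisors hx
  have hex := exact_lsmul_mkQ x
  refine subsingleton_of_forall_eq 0 fun y => ?_
  obtain ⟨z, rfl⟩ := (ModuleExt.exact_connecting_precomp M hinj (Submodule.mkQ_surjective _) hex
    (i + 1) y).1 (Ext.eq_zero_of_projective _)
  have : z = 0 := Ext.eq_zero_of_projective (P := ModuleCat.of A A) z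
  rw [this, map_zero]

end RegularElement

/-! ### Finite injective dimension and type in dimension one -/

section InjectiveDimension

variable {A : Type u} [CommRing A] [IsLocalRing A] (M : Type u) [AddCommGroup M] [Module A M]

/-- A nonzero Artinian module has a minimal submodule, and over a local ring this is a copy of the
residue field. -/
theorem exists_residueField_injective {N : Type*} [AddCommGroup N] [Module A N] [Nontrivial N]
    [IsArtinian A N] : ∃ f : IsLocalRing.ResidueField A →ₗ[A] N, Function.Injective f := by
  obtain ⟨S, hS⟩ := IsAtomic.exists_atom (Submodule A N)
  have : IsSimpleModule A S := isSimpleModule_iff_isAtom.mpr hS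
  obtain ⟨e⟩ := IsSimpleModule.nonempty_equiv_residueField (A := A) (N := S)
  exact ⟨S.subtype ∘ₗ e.symm.toLinearMap, S.subtype_injective.comp e.symm.injective⟩

/-- Over a local ring `A` with a nonzerodivisor `x` in the maximal ideal such that `A / x` has
finite length, a module of finite injective dimension has injective dimension at most `1` with
respect to the residue field. -/
theorem ModuleExt.subsingleton_residueField_of_finite_injectiveDimension {x : A}
    (hx : x ∈ nonZeroDivisors A) (hxm : x ∈ IsLocalRing.maximalIdeal A)
    (hfin : IsFiniteLength A (A ⧸ Ideal.span {x})) (hM : HasFiniteInjectiveDimension A M) (i : ℕ) :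
    Subsingleton (ModuleExt A (IsLocalRing.ResidueField A) M (i + 1 + 1)) := by
  obtain ⟨n, hn⟩ := hM
  -- Downward induction on the degree, `d` being the distance to the range where vanishing is known.
  -- From `0 → k → A/x → C → 0` the group `Ext^{i+2}(k, M)` sits between `Ext^{i+2}(A/x, M) = 0` and
  -- `Ext^{i+3}(C, M)`, which vanishes by induction because `C` has finite length.
  have key : ∀ d i : ℕ, n ≤ i + 1 + d →
      Subsingleton (ModuleExt A (IsLocalRing.ResidueField A) M (i + 1 + 1)) := by
    intro d
    induction d with
    | zero =>
      intro i hi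
      exact HasInjectiveDimensionLT.subsingleton _ (n + 1) _ (by omega) _
    | succ d ih =>
      intro i hi
      have hart := (isFiniteLength_iff_isNoetherian_isArtinian.mp hfin).2
      have : Nontrivial (A ⧸ Ideal.span {x}) := by
        rw [Ideal.Quotient.nontrivial_iff]
        rintro h
        exact (IsLocalRing.mem_maximalIdeal _).mp hxm (Ideal.span_singleton_eq_top.mp h)
      obtain ⟨f, hf⟩ := exists_residueField_injective (A := A) (N := A ⧸ Ideal.span {x})
      have hfC : IsFiniteLength A ((A ⧸ Ideal.span {x}) ⧸ LinearMap.range f) :=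
        hfin.of_surjective (Submodule.mkQ_surjective _)
      have s1 := ModuleExt.subsingleton_of_isFiniteLength M (ih (i + 1) (by omega)) hfC
      have s2 := ModuleExt.subsingleton_quotient_span M hx i
      refine subsingleton_of_forall_eq 0 fun y => ?_
      obtain ⟨z, rfl⟩ := (ModuleExt.exact_precomp_connecting M hf (Submodule.mkQ_surjective _)
        (LinearMap.exact_map_mkQ_range f) (i + 1 + 1) y).1 (Subsingleton.elim _ _)
      rw [Subsingleton.elim z 0, map_zero]
  exact key n i (by omega)

/-- Two counts of `ℓ(Ext¹(A/x, M))`: it equals `ℓ(M/xM) = ℓ(A/x)`, and by exact dévissage it equals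
`ℓ(A/x) · ℓ(Ext¹(k, M))`. Cancel the finite positive number `ℓ(A/x)`. -/
theorem ModuleExt.length_residueField_eq_one {x : A}
    (hx : x ∈ nonZeroDivisors A) (hxm : x ∈ IsLocalRing.maximalIdeal A)
    (hfin : IsFiniteLength A (A ⧸ Ideal.span {x})) (hM : HasFiniteInjectiveDimension A M)
    (h₀ : Subsingleton (ModuleExt A (IsLocalRing.ResidueField A) M 0))
    (hl : Module.length A (M ⧸ LinearMap.range (LinearMap.lsmul A M x)) =
      Module.length A (A ⧸ Ideal.span {x})) :
    Module.length A (ModuleExt A (IsLocalRing.ResidueField A) M 1) = 1 := by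
  have h₂ := ModuleExt.subsingleton_residueField_of_finite_injectiveDimension M hx hxm hfin hM 0
  have h := ModuleExt.length_eq M h₀ h₂ hfin
  rw [zero_add, ModuleExt.length_quotient_smul_eq M hx, hl] at h
  have hne : Module.length A (A ⧸ Ideal.span {x}) ≠ ⊤ := Module.length_ne_top_iff.mpr hfin
  have hne0 : Module.length A (A ⧸ Ideal.span {x}) ≠ 0 := by
    rw [ne_eq, Module.length_eq_zero_iff, Submodule.Quotient.subsingleton_iff]
    intro h
    exact (IsLocalRing.mem_maximalIdeal _).mp hxm (Ideal.span_singleton_eq_top.mp h)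
  generalize Module.length A (ModuleExt A (IsLocalRing.ResidueField A) M 1) = r at h
  lift Module.length A (A ⧸ Ideal.span {x}) to ℕ using hne with a
  induction r using ENat.recTopCoe with
  | top => rw [ENat.mul_top hne0] at h; exact absurd h (ENat.natCast_ne_top a)
  | coe r =>
    norm_cast at h hne0 ⊢
    exact (Nat.eq_of_mul_eq_mul_left (Nat.pos_of_ne_zero hne0) (by rw [mul_one]; exact h)).symm

theorem ModuleExt.subsingleton_zero_of_smul_injective {x : A}
    (hxm : x ∈ IsLocalRing.maximalIdeal A) (hx : ∀ m : M, x • m = 0 → m = 0) :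
    Subsingleton (ModuleExt A (IsLocalRing.ResidueField A) M 0) := by
  have : Subsingleton (IsLocalRing.ResidueField A →ₗ[A] M) := by
    refine subsingleton_of_forall_eq 0 fun f => LinearMap.ext fun y => hx _ ?_
    rw [← map_smul]
    obtain ⟨a, rfl⟩ := IsLocalRing.residue_surjective y
    have : x • IsLocalRing.residue A a = IsLocalRing.residue A (x * a) := rfl
    rw [this, (IsLocalRing.residue_eq_zero_iff _).mpr (Ideal.mul_mem_right _ _ hxm), map_zero]
  exact (ModuleExt.zeroEquiv M (IsLocalRing.ResidueField A)).toEquiv.subsingleton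

end InjectiveDimension

/-! ## Colon submodules and `Ext` -/

section Colon

variable {A B : Type u} [CommRing A] [CommRing B] [IsDomain B] [Algebra A B]

/-- Multiplication by `q ∈ M : I` is a map `I → M`; its connecting class in `Ext¹(J/I, M)` vanishes
exactly when it extends to `J`. As `J/I` is torsion by `hden`, such an extension is again
multiplication by `q`, which means `q ∈ M : J`. -/
theorem length_div_quotient_le (M : Submodule A B) {I J : Submodule A B}
    (hden : ∀ b ∈ J, ∃ r : A, algebraMap A B r ≠ 0 ∧ r • b ∈ I) :
    Module.length A (↥(M / I) ⧸ (M / J).submoduleOf (M / I)) ≤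
      Module.length A (ModuleExt A (↥J ⧸ I.submoduleOf J) M 1) := by
  let φ : ↥(M / I) →ₗ[A] (↥(I.submoduleOf J) →ₗ[A] M) :=
    { toFun q :=
        { toFun y := ⟨q * y.1, Submodule.mem_div_iff_forall_mul_mem.mp q.2 _ y.2⟩
          map_add' y z := by ext; simp [mul_add]
          map_smul' a y := by ext; simp }
      map_add' q r := by ext; simp [add_mul]
      map_smul' a q := by ext; simp }
  have hex : Function.Exact (I.submoduleOf J).subtype (I.submoduleOf J).mkQ :=
    LinearMap.exact_subtype_mkQ _
  let δ := ModuleExt.homConnecting M (Submodule.subtype_injective _) (Submodule.mkQ_surjective _)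
    hex ∘ₗ φ
  have hk : LinearMap.ker δ = (M / J).submoduleOf (M / I) := by
    ext q
    rw [LinearMap.mem_ker, LinearMap.comp_apply, ModuleExt.homConnecting_eq_zero_iff]
    change _ ↔ (q : B) ∈ M / J
    rw [Submodule.mem_div_iff_forall_mul_mem]
    constructor
    · rintro ⟨ψ, hψ⟩ b hb
      obtain ⟨r, hr, hrb⟩ := hden b hb
      have h1 : (ψ (r • ⟨b, hb⟩) : B) = q * (r • b) := by
        have := LinearMap.congr_fun hψ ⟨r • ⟨b, hb⟩, hrb⟩
        simpa [φ] using congrArg Subtype.val this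
      rw [map_smul, Submodule.coe_smul, mul_smul_comm, Algebra.smul_def, Algebra.smul_def] at h1
      rw [← mul_left_cancel₀ hr h1]
      exact (ψ ⟨b, hb⟩).2
    · intro h
      refine ⟨{ toFun y := ⟨q * y.1, h _ y.2⟩
                map_add' y z := by ext; simp [mul_add]
                map_smul' a y := by ext; simp }, ?_⟩
      ext y
      simp [φ]
  rw [← hk]
  exact (δ.quotKerEquivRange.length_eq).le.trans
    (Module.length_le_of_injective _ (Submodule.subtype_injective _))

end Colon

/-! ## Modules of type one have rank one -/

theorem Module.length_quotient_range_comp {A X Y Z : Type*} [Ring A] [AddCommGroup X]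
    [AddCommGroup Y] [AddCommGroup Z] [Module A X] [Module A Y] [Module A Z] (φ : X →ₗ[A] Y)
    {ψ : Y →ₗ[A] Z} (hψ : Function.Injective ψ) :
    Module.length A (Z ⧸ LinearMap.range (ψ ∘ₗ φ)) =
      Module.length A (Y ⧸ LinearMap.range φ) + Module.length A (Z ⧸ LinearMap.range ψ) := by
  have h1 : LinearMap.range φ ≤ (LinearMap.range (ψ ∘ₗ φ)).comap ψ := by
    rintro _ ⟨x, rfl⟩; exact ⟨x, rfl⟩
  have h2 : LinearMap.range (ψ ∘ₗ φ) ≤ LinearMap.range ψ := LinearMap.range_comp_le_range φ ψ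
  refine Module.length_eq_add_of_exact (Submodule.mapQ _ _ ψ h1) (Submodule.factor h2) ?_
    (Submodule.factor_surjective h2) ?_
  · rw [← LinearMap.ker_eq_bot, LinearMap.ker_eq_bot']
    intro y hy
    obtain ⟨y, rfl⟩ := Submodule.mkQ_surjective _ y
    rw [Submodule.mkQ_apply, Submodule.mapQ_apply, Submodule.Quotient.mk_eq_zero] at hy
    obtain ⟨x, hx⟩ := hy
    rw [Submodule.mkQ_apply, Submodule.Quotient.mk_eq_zero]
    exact ⟨x, hψ hx⟩
  · intro z
    obtain ⟨z, rfl⟩ := Submodule.mkQ_surjective _ z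
    rw [Submodule.mkQ_apply, Submodule.factor, Submodule.mapQ_apply, LinearMap.id_apply,
      Submodule.Quotient.mk_eq_zero]
    constructor
    · rintro ⟨y, rfl⟩
      exact ⟨Submodule.Quotient.mk y, rfl⟩
    · rintro ⟨y, hy⟩
      obtain ⟨y, rfl⟩ := Submodule.mkQ_surjective _ y
      rw [Submodule.mkQ_apply, Submodule.mapQ_apply, Submodule.Quotient.eq] at hy
      have := (LinearMap.range ψ).sub_mem ⟨y, rfl⟩ (h2 hy)
      simpa using this

/-- If `a m = 0` with both nonzero, then `Am` is a quotient of `A/a`, hence of finite length, and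
contains a copy of the residue field, against `Hom(k, M) = 0`. -/
theorem torsionFree_of_subsingleton_ext {A : Type u} [CommRing A] [IsLocalRing A]
    (hA : ∀ y : A, y ≠ 0 → IsFiniteLength A (A ⧸ Ideal.span {y}))
    {M : Type u} [AddCommGroup M] [Module A M]
    (h₀ : Subsingleton (ModuleExt A (IsLocalRing.ResidueField A) M 0)) (a : A) (m : M)
    (ham : a • m = 0) : a = 0 ∨ m = 0 := by
  by_contra! h
  obtain ⟨ha, hm⟩ := h
  have hle : Ideal.span {a} ≤ LinearMap.ker (LinearMap.toSpanSingleton A M m) := by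
    rw [Ideal.span_singleton_le_iff_mem]; simpa using ham
  have hfin : IsFiniteLength A (Submodule.span A {m}) := by
    rw [LinearMap.span_singleton_eq_range]
    exact ((hA a ha).of_surjective (Submodule.factor_surjective hle)).of_surjective
      (LinearMap.quotKerEquivRange _).surjective
  have hart := (isFiniteLength_iff_isNoetherian_isArtinian.mp hfin).2
  have : Nontrivial (Submodule.span A {m}) :=
    ⟨⟨⟨m, Submodule.mem_span_singleton_self m⟩, 0, fun h => hm (congrArg Subtype.val h)⟩⟩
  obtain ⟨f, hf⟩ := exists_residueField_injective (A := A) (N := Submodule.span A {m})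
  have hs : Subsingleton (IsLocalRing.ResidueField A →ₗ[A] M) :=
    (ModuleExt.zeroEquiv M (IsLocalRing.ResidueField A)).symm.toEquiv.subsingleton
  have h0 : (Submodule.span A {m}).subtype ∘ₗ f = 0 := Subsingleton.elim _ _
  have h1 : f 1 = 0 := Subtype.ext (LinearMap.congr_fun h0 1)
  exact one_ne_zero (hf (h1.trans (map_zero f).symm))

section Rank

variable {A : Type u} [CommRing A] [IsDomain A]

/-- Since `f ∘ x = x ∘ f`, the cokernel of this composite has two length counts: `ℓ(P/xP) +
ℓ(A/f(P))` and `ℓ(A/f(P)) + ℓ(A/xA)`. The common term is finite because `f(P)` contains a nonzero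
element. -/
theorem length_quotient_lsmul_of_injective
    (hA : ∀ y : A, y ≠ 0 → IsFiniteLength A (A ⧸ Ideal.span {y}))
    {P : Type u} [AddCommGroup P] [Module A P] [Nontrivial P] {f : P →ₗ[A] A}
    (hf : Function.Injective f) {x : A} (hx : x ≠ 0) :
    Module.length A (P ⧸ LinearMap.range (LinearMap.lsmul A P x)) =
      Module.length A (A ⧸ Ideal.span {x}) := by
  have hinj : Function.Injective (LinearMap.lsmul A A x) :=
    lsmul_injective_of_mem_nonZeroDivisors (mem_nonZeroDivisors_of_ne_zero hx)
  have h1 := Module.length_quotient_range_comp (LinearMap.lsmul A P x) hf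
  have h2 := Module.length_quotient_range_comp f hinj
  have hc : f ∘ₗ LinearMap.lsmul A P x = LinearMap.lsmul A A x ∘ₗ f := by ext; simp
  have hx' : LinearMap.range (LinearMap.lsmul A A x) = Ideal.span {x} := by
    rw [← (exact_lsmul_mkQ x).linearMap_ker_eq, Submodule.ker_mkQ]
  rw [hc, h2, hx', add_comm] at h1
  obtain ⟨p, hp⟩ := exists_ne (0 : P)
  have hp' : f p ≠ 0 := fun h => hp (hf (by rw [h, map_zero]))
  have hle : Ideal.span {f p} ≤ LinearMap.range f := by
    rw [Ideal.span_singleton_le_iff_mem]; exact ⟨p, rfl⟩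
  have hfin : Module.length A (A ⧸ LinearMap.range f) ≠ ⊤ := Module.length_ne_top_iff.mpr
    ((hA _ hp').of_surjective (Submodule.factor_surjective hle))
  exact (ENat.add_left_injective_of_ne_top hfin h1).symm

/-- The product of denominators of a finite generating set multiplies `P` into the free module `A p₀
≅ A`, injectively since `P` is torsion-free. -/
theorem exists_injective_of_torsion_mod_span {P : Type u} [AddCommGroup P] [Module A P]
    [Module.Finite A P] (htf : ∀ (a : A) (p : P), a • p = 0 → a = 0 ∨ p = 0) {p₀ : P} (hp₀ : p₀ ≠ 0)
    (h : ∀ p : P, ∃ r : A, r ≠ 0 ∧ r • p ∈ Submodule.span A {p₀}) :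
    ∃ f : P →ₗ[A] A, Function.Injective f := by
  classical
  choose r hr0 hr using h
  obtain ⟨S, hS⟩ : ∃ S : Finset P, Submodule.span A (S : Set P) = ⊤ := Module.Finite.fg_top
  have hR : (∏ s ∈ S, r s) ≠ 0 := Finset.prod_ne_zero_iff.mpr fun s _ => hr0 s
  have hmem : ∀ p, (∏ s ∈ S, r s) • p ∈ Submodule.span A {p₀} := by
    intro p
    have hle : Submodule.span A (S : Set P) ≤
        (Submodule.span A {p₀}).comap (LinearMap.lsmul A P (∏ s ∈ S, r s)) := by
      rw [Submodule.span_le]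
      intro s hs
      change (∏ s ∈ S, r s) • s ∈ Submodule.span A {p₀}
      rw [← Finset.prod_erase_mul S r (Finset.mem_coe.mp hs), mul_smul]
      exact Submodule.smul_mem _ _ (hr s)
    exact hle (hS ▸ Submodule.mem_top)
  let g : A →ₗ[A] P := LinearMap.toSpanSingleton A P p₀
  have hg : Function.Injective g := by
    rw [injective_iff_map_eq_zero]
    intro a ha
    exact (htf a p₀ ha).resolve_right hp₀
  let e := LinearEquiv.ofInjective g hg
  have hrange : LinearMap.range g = Submodule.span A {p₀} :=
    (LinearMap.span_singleton_eq_range A P p₀).symm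
  refine ⟨e.symm.toLinearMap ∘ₗ
    (LinearMap.lsmul A P (∏ s ∈ S, r s)).codRestrict _ (fun p => hrange ▸ hmem p), ?_⟩
  refine e.symm.injective.comp ?_
  rw [injective_iff_map_eq_zero]
  intro p hp
  exact (htf _ p (congrArg Subtype.val hp)).resolve_left hR

variable [IsLocalRing A]

/-- Type one forces rank one. Let `P` be a saturated rank-one submodule. Then `ℓ(M/xM) = ℓ(P/xP) +
ℓ((M/P)/x(M/P))` with `ℓ(P/xP) = ℓ(A/x)`, whereas `ℓ(M/xM) = ℓ(Ext¹(A/x, M)) ≤ ℓ(A/x)`. So the last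
summand is zero, and `M = P` by Nakayama. -/
theorem exists_injective_of_length_ext_eq_one [IsNoetherianRing A]
    (hA : ∀ y : A, y ≠ 0 → IsFiniteLength A (A ⧸ Ideal.span {y})) (hfield : ¬ IsField A)
    {M : Type u} [AddCommGroup M] [Module A M] [Module.Finite A M] [Nontrivial M]
    (h₀ : Subsingleton (ModuleExt A (IsLocalRing.ResidueField A) M 0))
    (h₁ : Module.length A (ModuleExt A (IsLocalRing.ResidueField A) M 1) = 1) :
    ∃ f : M →ₗ[A] A, Function.Injective f := by
  have htf := torsionFree_of_subsingleton_ext hA h₀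
  obtain ⟨x, hxm, hx⟩ := Submodule.exists_mem_ne_zero_of_ne_bot
    (fun h => hfield (IsLocalRing.isField_iff_maximalIdeal_eq.mpr h))
  obtain ⟨m₀, hm₀⟩ := exists_ne (0 : M)
  -- The saturation of `A m₀`: `M/P` is torsion-free, so `P/xP → M/xM` is injective.
  let P : Submodule A M :=
    { carrier := {p | ∃ r : A, r ≠ 0 ∧ r • p ∈ Submodule.span A {m₀}}
      zero_mem' := ⟨1, one_ne_zero, by simp⟩
      add_mem' := by
        rintro p q ⟨r, hr, hp⟩ ⟨s, hs, hq⟩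
        refine ⟨r * s, mul_ne_zero hr hs, ?_⟩
        rw [smul_add]
        refine add_mem ?_ ?_
        · rw [mul_comm, mul_smul]; exact Submodule.smul_mem _ _ hp
        · rw [mul_smul]; exact Submodule.smul_mem _ _ hq
      smul_mem' := by
        rintro a p ⟨r, hr, hp⟩
        exact ⟨r, hr, by rw [smul_comm]; exact Submodule.smul_mem _ _ hp⟩ }
  have hm₀P : m₀ ∈ P := ⟨1, one_ne_zero, by simp⟩
  have hsat : ∀ (r : A) (m : M), r ≠ 0 → r • m ∈ P → m ∈ P := by
    rintro r m hr ⟨s, hs, hsm⟩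
    exact ⟨s * r, mul_ne_zero hs hr, by rwa [mul_smul]⟩
  suffices hP : P = ⊤ by
    refine exists_injective_of_torsion_mod_span htf hm₀ fun p => ?_
    have : p ∈ P := hP ▸ Submodule.mem_top
    exact this
  by_contra hP
  obtain ⟨f, hf⟩ := exists_injective_of_torsion_mod_span (P := P) (p₀ := ⟨m₀, hm₀P⟩)
    (fun a p hap => (htf a p (congrArg Subtype.val hap)).imp_right Subtype.ext)
    (fun h => hm₀ (congrArg Subtype.val h)) (by
      rintro ⟨p, r, hr, hp⟩
      refine ⟨r, hr, ?_⟩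
      obtain ⟨a, ha⟩ := Submodule.mem_span_singleton.mp hp
      exact Submodule.mem_span_singleton.mpr ⟨a, Subtype.ext ha⟩)
  have : Nontrivial P := ⟨⟨⟨m₀, hm₀P⟩, 0, fun h => hm₀ (congrArg Subtype.val h)⟩⟩
  have hPx := length_quotient_lsmul_of_injective hA hf hx
  have hC : Nontrivial (M ⧸ P) := Submodule.Quotient.nontrivial_iff.mpr hP
  have hCx : Nontrivial ((M ⧸ P) ⧸ LinearMap.range (LinearMap.lsmul A (M ⧸ P) x)) := by
    rw [Submodule.Quotient.nontrivial_iff]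
    intro h
    have := Submodule.eq_bot_of_le_smul_of_le_jacobson_bot (Ideal.span {x})
      (⊤ : Submodule A (M ⧸ P)) Module.Finite.fg_top (by
        rintro c -
        obtain ⟨d, rfl⟩ : c ∈ LinearMap.range (LinearMap.lsmul A (M ⧸ P) x) :=
          h ▸ Submodule.mem_top
        exact Submodule.smul_mem_smul (Ideal.mem_span_singleton_self x) Submodule.mem_top)
      (by
        rw [IsLocalRing.jacobson_eq_maximalIdeal ⊥ bot_ne_top, Ideal.span_singleton_le_iff_mem]
        exact hxm)
    exact top_ne_bot this
  have h1 : LinearMap.range (LinearMap.lsmul A P x) ≤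
      (LinearMap.range (LinearMap.lsmul A M x)).comap P.subtype := by
    rintro _ ⟨p, rfl⟩; exact ⟨p, rfl⟩
  have h2 : LinearMap.range (LinearMap.lsmul A M x) ≤
      (LinearMap.range (LinearMap.lsmul A (M ⧸ P) x)).comap P.mkQ := by
    rintro _ ⟨p, rfl⟩; exact ⟨P.mkQ p, rfl⟩
  have hlen := Module.length_eq_add_of_exact (Submodule.mapQ _ _ P.subtype h1)
    (Submodule.mapQ _ _ P.mkQ h2)
    (by
      rw [injective_iff_map_eq_zero]
      intro p hp
      obtain ⟨p, rfl⟩ := Submodule.mkQ_surjective _ p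
      rw [Submodule.mkQ_apply, Submodule.mapQ_apply, Submodule.Quotient.mk_eq_zero] at hp
      obtain ⟨m, hm⟩ := hp
      have hmP : m ∈ P := hsat x m hx (by
        have : x • m = (p : M) := hm
        rw [this]; exact p.2)
      rw [Submodule.mkQ_apply, Submodule.Quotient.mk_eq_zero]
      exact ⟨⟨m, hmP⟩, Subtype.ext hm⟩)
    (by
      intro c
      obtain ⟨c, rfl⟩ := Submodule.mkQ_surjective _ c
      obtain ⟨c, rfl⟩ := P.mkQ_surjective c
      exact ⟨Submodule.Quotient.mk c, rfl⟩)
    (by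
      intro c
      obtain ⟨c, rfl⟩ := Submodule.mkQ_surjective _ c
      rw [Submodule.mkQ_apply, Submodule.mapQ_apply, Submodule.Quotient.mk_eq_zero]
      constructor
      · rintro ⟨d, hd⟩
        obtain ⟨d, rfl⟩ := P.mkQ_surjective d
        have hd' : P.mkQ (x • d) = P.mkQ c := hd
        rw [Submodule.mkQ_apply, Submodule.mkQ_apply, Submodule.Quotient.eq] at hd'
        refine ⟨- Submodule.Quotient.mk ⟨_, hd'⟩, ?_⟩
        rw [← Submodule.Quotient.mk_neg, Submodule.mapQ_apply, Submodule.Quotient.eq]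
        exact ⟨-d, by simp⟩
      · rintro ⟨p, hp⟩
        obtain ⟨p, rfl⟩ := Submodule.mkQ_surjective _ p
        rw [Submodule.mkQ_apply, Submodule.mapQ_apply, Submodule.Quotient.eq] at hp
        obtain ⟨m, hm⟩ := hp
        refine ⟨P.mkQ (-m), ?_⟩
        have hm' : x • m = (p : M) - c := hm
        change x • P.mkQ (-m) = P.mkQ c
        rw [← map_smul, smul_neg, hm', neg_sub, map_sub]
        have : P.mkQ (p : M) = 0 := by simp
        rw [this, sub_zero])
  have hle := ModuleExt.length_le M (hA x hx) 1
  rw [ModuleExt.length_quotient_smul_eq M (mem_nonZeroDivisors_of_ne_zero hx), h₁, mul_one, hlen,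
    hPx] at hle
  have hne : Module.length A (A ⧸ Ideal.span {x}) ≠ ⊤ := Module.length_ne_top_iff.mpr (hA x hx)
  have hpos := Module.length_pos (R := A)
    (M := (M ⧸ P) ⧸ LinearMap.range (LinearMap.lsmul A (M ⧸ P) x))
  rw [← add_zero (Module.length A (A ⧸ Ideal.span {x}))] at hle
  exact absurd ((ENat.add_le_add_iff_left hne).mp (by simpa using hle)) (not_le.mpr hpos)

end Rank

/-! ## The ring structure of `K[[H]]` -/

/-- The quotient is an Artinian ring, so every prime containing `I` is maximal. -/
theorem maximalIdeal_le_radical_of_isFiniteLength {A : Type*} [CommRing A] [IsLocalRing A]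
    {I : Ideal A} (hI : IsFiniteLength A (A ⧸ I)) : IsLocalRing.maximalIdeal A ≤ I.radical := by
  have hart := (isFiniteLength_iff_isNoetherian_isArtinian.mp hI).2
  have : IsArtinianRing (A ⧸ I) := isArtinian_of_tower A hart
  rw [Ideal.radical_eq_sInf]
  refine le_sInf fun P ⟨hIP, hP⟩ => ?_
  have hP' : (P.map (Ideal.Quotient.mk I)).IsPrime :=
    Ideal.map_isPrime_of_surjective Ideal.Quotient.mk_surjective (by rwa [Ideal.mk_ker])
  have hmax := IsArtinianRing.isMaximal_of_isPrime (P.map (Ideal.Quotient.mk I))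
  have := Ideal.comap_isMaximal_of_surjective (Ideal.Quotient.mk I) Ideal.Quotient.mk_surjective
    (K := P.map (Ideal.Quotient.mk I))
  rw [Ideal.comap_map_of_surjective _ Ideal.Quotient.mk_surjective, ← RingHom.ker_eq_comap_bot,
    Ideal.mk_ker, sup_eq_left.mpr hIP] at this
  exact (IsLocalRing.eq_maximalIdeal this).ge

section PowerSeries

variable {K : Type u} [Field K]

theorem PowerSeries.exists_X_pow_eq_mul {g : PowerSeries K} (hg : g ≠ 0) :
    ∃ (d : ℕ) (v : PowerSeries K), PowerSeries.X ^ d = v * g ∧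
      PowerSeries.constantCoeff v ≠ 0 := by
  have h : PowerSeries.constantCoeff g.divXPowOrder ≠ 0 := by
    rwa [ne_eq, PowerSeries.constantCoeff_divXPowOrder_eq_zero_iff]
  refine ⟨g.order.toNat, (g.divXPowOrder)⁻¹, ?_, by simpa using h⟩
  calc _ = PowerSeries.X ^ g.order.toNat * (g.divXPowOrder⁻¹ * g.divXPowOrder) := by
        rw [PowerSeries.inv_mul_cancel _ h, mul_one]
    _ = g.divXPowOrder⁻¹ * (PowerSeries.X ^ g.order.toNat * g.divXPowOrder) := mul_left_comm _ _ _
    _ = _ := by rw [PowerSeries.X_pow_order_mul_divXPowOrder]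

theorem PowerSeries.exists_eq_sum_add_X_pow_mul (N : ℕ) (f : PowerSeries K) :
    ∃ h, f = ∑ i ∈ Finset.range N, PowerSeries.coeff i f • PowerSeries.X ^ i +
      PowerSeries.X ^ N * h := by
  obtain ⟨h, hh⟩ : PowerSeries.X ^ N ∣
      f - ∑ i ∈ Finset.range N, PowerSeries.coeff i f • (PowerSeries.X : PowerSeries K) ^ i := by
    rw [PowerSeries.X_pow_dvd_iff]
    intro m hm
    rw [map_sub, map_sum, Finset.sum_eq_single m]
    · simp
    · intro i _ hi
      simp [PowerSeries.coeff_X_pow, hi.symm]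
    · intro h; exact absurd (Finset.mem_range.mpr hm) h
  exact ⟨h, by rw [← hh]; ring⟩

variable {H : AddSubmonoid ℕ}

theorem IsNumericalSemigroup.exists_conductor (hH : IsNumericalSemigroup H) :
    ∃ c, 0 < c ∧ ∀ n, c ≤ n → n ∈ H := by
  obtain ⟨b, hb⟩ := hH.bddAbove
  refine ⟨b + 1, b.succ_pos, fun n hn => ?_⟩
  by_contra h
  exact absurd (hb h) (by omega)

/-- `R` is the ring `K[[H]]`, up to isomorphism: it embeds into `K[[t]]` with image the power
series all of whose exponents lie in `H`. -/
structure IsSemigroupRing (K : Type u) [Field K] (H : AddSubmonoid ℕ) (R : Type u) [CommRing R]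
    [Algebra K R] [Algebra R (PowerSeries K)] : Prop where
  numerical : IsNumericalSemigroup H
  tower : IsScalarTower K R (PowerSeries K)
  injective : Function.Injective (algebraMap R (PowerSeries K))
  mem_range_iff : ∀ f : PowerSeries K,
    (∃ r : R, algebraMap R (PowerSeries K) r = f) ↔ ∀ n, n ∉ H → PowerSeries.coeff n f = 0

theorem range_algebraMap_ne_bot {R : Type u} [CommRing R] [Algebra R (PowerSeries K)] :
    LinearMap.range (Algebra.linearMap R (PowerSeries K)) ≠ ⊥ := by
  intro h
  have : Algebra.linearMap R (PowerSeries K) 1 ∈ LinearMap.range (Algebra.linearMap R (PowerSeries K)) := ⟨1, rfl⟩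
  rw [h, Submodule.mem_bot, Algebra.linearMap_apply, map_one] at this
  exact one_ne_zero this

namespace IsSemigroupRing

variable {R : Type u} [CommRing R] [Algebra K R] [Algebra R (PowerSeries K)]

theorem coeff_eq_zero (hR : IsSemigroupRing K H R) (r : R) {n : ℕ} (hn : n ∉ H) :
    PowerSeries.coeff n (algebraMap R (PowerSeries K) r) = 0 :=
  (hR.mem_range_iff _).mp ⟨r, rfl⟩ n hn

theorem exists_eq_X_pow_mul (hR : IsSemigroupRing K H R) {c : ℕ} (hc : ∀ n, c ≤ n → n ∈ H)
    (f : PowerSeries K) :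
    ∃ r : R, algebraMap R (PowerSeries K) r = PowerSeries.X ^ c * f := by
  rw [hR.mem_range_iff]
  intro n hn
  rw [PowerSeries.coeff_X_pow_mul', if_neg]
  exact fun h => hn (hc n h)

theorem isDomain (hR : IsSemigroupRing K H R) : IsDomain R :=
  hR.injective.isDomain (algebraMap R (PowerSeries K))

theorem isUnit_iff (hR : IsSemigroupRing K H R) {a : R} :
    IsUnit a ↔ PowerSeries.constantCoeff (algebraMap R (PowerSeries K) a) ≠ 0 := by
  constructor
  · intro h
    exact (PowerSeries.isUnit_iff_constantCoeff.mp (h.map (algebraMap R (PowerSeries K)))).ne_zero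
  · intro h
    obtain ⟨b, hb⟩ : ∃ b : R,
      algebraMap R (PowerSeries K) b = (algebraMap R (PowerSeries K) a)⁻¹ := by
      rw [hR.mem_range_iff]
      exact inv_mem_semigroupRing (K := K) (fun n hn => hR.coeff_eq_zero a hn)
    refine IsUnit.of_mul_eq_one b (hR.injective ?_)
    rw [map_mul, hb, PowerSeries.mul_inv_cancel _ h, map_one]

theorem isLocalRing (hR : IsSemigroupRing K H R) : IsLocalRing R := by
  have : Nontrivial R := (hR.isDomain).toNontrivial
  refine IsLocalRing.of_isUnit_or_isUnit_one_sub_self fun a => ?_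
  rw [hR.isUnit_iff, hR.isUnit_iff]
  by_cases ha : PowerSeries.constantCoeff (algebraMap R (PowerSeries K) a) = 0
  · right; simp [ha]
  · exact Or.inl ha

/-- A nonzero `g` in `M` is a unit times `t^d`, and `R` contains `t^c K[[t]]`; so `M` contains
`t^(c+d) K[[t]]`. -/
theorem exists_X_pow_mul_mem (hR : IsSemigroupRing K H R) {M : Submodule R (PowerSeries K)}
    (hM : M ≠ ⊥) :
    ∃ N, ∀ f, PowerSeries.X ^ N * f ∈ M := by
  obtain ⟨c, -, hc⟩ := hR.numerical.exists_conductor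
  obtain ⟨g, hg, hg0⟩ := Submodule.exists_mem_ne_zero_of_ne_bot hM
  obtain ⟨d, v, hv, -⟩ := PowerSeries.exists_X_pow_eq_mul hg0
  refine ⟨c + d, fun f => ?_⟩
  obtain ⟨r, hr⟩ := hR.exists_eq_X_pow_mul hc (f * v)
  have : PowerSeries.X ^ (c + d) * f = r • g := by
    rw [Algebra.smul_def, hr, pow_add, hv]
    ring
  rw [this]
  exact M.smul_mem _ hg

theorem isFiniteLength_quotient (hR : IsSemigroupRing K H R) {M : Submodule R (PowerSeries K)}
    (hM : M ≠ ⊥) : IsFiniteLength R (PowerSeries K ⧸ M) := by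
  have := hR.tower
  obtain ⟨N, hN⟩ := hR.exists_X_pow_mul_mem hM
  have hfin : Module.Finite K (PowerSeries K ⧸ M) := by
    let φ : (Fin N → K) →ₗ[K] (PowerSeries K ⧸ M) :=
      (M.mkQ.restrictScalars K) ∘ₗ Fintype.linearCombination K (fun i : Fin N =>
        (PowerSeries.X : PowerSeries K) ^ (i : ℕ))
    refine Module.Finite.of_surjective φ fun v => ?_
    obtain ⟨f, rfl⟩ := M.mkQ_surjective v
    obtain ⟨h, hh⟩ := PowerSeries.exists_eq_sum_add_X_pow_mul N f
    refine ⟨fun i => PowerSeries.coeff i f, ?_⟩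
    have : f = Fintype.linearCombination K (fun i : Fin N => (PowerSeries.X : PowerSeries K) ^ (i : ℕ))
        (fun i => PowerSeries.coeff i f) + PowerSeries.X ^ N * h := by
      conv_lhs => rw [hh]
      rw [Fintype.linearCombination_apply, Finset.sum_range]
    conv_rhs => rw [this]
    rw [map_add, (Submodule.mkQ_apply M _).trans ((Submodule.Quotient.mk_eq_zero M).mpr (hN h)),
      add_zero]
    rfl
  exact isFiniteLength_iff_isNoetherian_isArtinian.mpr
    ⟨isNoetherian_of_tower K inferInstance, isArtinian_of_tower K inferInstance⟩

theorem finite (hR : IsSemigroupRing K H R) : Module.Finite R (PowerSeries K) := by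
  have h1 := (isFiniteLength_iff_isNoetherian_isArtinian.mp
    (hR.isFiniteLength_quotient range_algebraMap_ne_bot)).1
  exact Module.Finite.of_submodule_quotient (LinearMap.range (Algebra.linearMap R (PowerSeries K)))

/-- A nonzero submodule contains some `t^N K[[t]]`, which is finitely generated over `R` and has a
quotient of finite length in `K[[t]]`. -/
theorem isNoetherian (hR : IsSemigroupRing K H R) : IsNoetherian R (PowerSeries K) := by
  refine ⟨fun M => ?_⟩
  by_cases hM : M = ⊥
  · rw [hM]; exact Submodule.fg_bot
  obtain ⟨N, hN⟩ := hR.exists_X_pow_mul_mem hM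
  let μ : PowerSeries K →ₗ[R] PowerSeries K := LinearMap.mulLeft R (PowerSeries.X ^ N)
  have hμ0 : LinearMap.range μ ≠ ⊥ := by
    intro h
    have : μ 1 ∈ LinearMap.range μ := ⟨1, rfl⟩
    rw [h, Submodule.mem_bot] at this
    simp [μ] at this
  have hfin := (isFiniteLength_iff_isNoetherian_isArtinian.mp (hR.isFiniteLength_quotient hμ0)).1
  have := hR.finite
  refine Submodule.fg_of_fg_map_of_fg_inf_ker (LinearMap.range μ).mkQ (IsNoetherian.noetherian _) ?_
  have : M ⊓ LinearMap.ker (LinearMap.range μ).mkQ = LinearMap.range μ := by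
    rw [Submodule.ker_mkQ, inf_eq_right]
    rintro _ ⟨f, rfl⟩
    exact hN f
  rw [this, LinearMap.range_eq_map]
  exact Module.Finite.fg_top.map μ

theorem isNoetherianRing (hR : IsSemigroupRing K H R) : IsNoetherianRing R :=
  have := hR.isNoetherian
  isNoetherian_of_injective (Algebra.linearMap R (PowerSeries K)) hR.injective

theorem isFiniteLength_quotient_span (hR : IsSemigroupRing K H R) (y : R) (hy : y ≠ 0) :
    IsFiniteLength R (R ⧸ Ideal.span {y}) := by
  have h0 : Submodule.map (Algebra.linearMap R (PowerSeries K)) (Ideal.span {y}) ≠ ⊥ := by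
    intro h
    refine hy (hR.injective ?_)
    rw [map_zero, ← Submodule.mem_bot R, ← h]
    exact Submodule.mem_map_of_mem (f := Algebra.linearMap R (PowerSeries K)) (Ideal.mem_span_singleton_self y)
  refine (hR.isFiniteLength_quotient h0).of_injective
    (f := Submodule.mapQ _ _ (Algebra.linearMap R (PowerSeries K)) (Submodule.le_comap_map _ _)) ?_
  rw [← LinearMap.ker_eq_bot, LinearMap.ker_eq_bot']
  intro a ha
  obtain ⟨a, rfl⟩ := Submodule.mkQ_surjective _ a
  rw [Submodule.mkQ_apply, Submodule.mapQ_apply, Submodule.Quotient.mk_eq_zero] at ha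
  obtain ⟨b, hb, hab⟩ := ha
  rw [Submodule.mkQ_apply, Submodule.Quotient.mk_eq_zero, ← hR.injective hab]
  exact hb

theorem mem_maximalIdeal_iff (hR : IsSemigroupRing K H R) [IsLocalRing R] {a : R} :
    a ∈ IsLocalRing.maximalIdeal R ↔ PowerSeries.constantCoeff (algebraMap R (PowerSeries K) a) = 0 := by
  rw [IsLocalRing.mem_maximalIdeal, mem_nonunits_iff, hR.isUnit_iff, not_not]

theorem exists_mem_maximalIdeal_eq_X_pow_mul (hR : IsSemigroupRing K H R) [IsLocalRing R] {c : ℕ}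
    (hc0 : 0 < c)
    (hc : ∀ n, c ≤ n → n ∈ H) (f : PowerSeries K) :
    ∃ r ∈ IsLocalRing.maximalIdeal R, algebraMap R (PowerSeries K) r = PowerSeries.X ^ c * f := by
  obtain ⟨r, hr⟩ := hR.exists_eq_X_pow_mul hc f
  refine ⟨r, ?_, hr⟩
  rw [hR.mem_maximalIdeal_iff, hr]
  simp [hc0.ne']

theorem not_isField (hR : IsSemigroupRing K H R) : ¬ IsField R := by
  have := hR.isLocalRing
  obtain ⟨c, hc0, hc⟩ := hR.numerical.exists_conductor
  rw [IsLocalRing.isField_iff_maximalIdeal_eq]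
  intro h
  obtain ⟨r, hr, hr'⟩ := hR.exists_mem_maximalIdeal_eq_X_pow_mul hc0 hc 1
  rw [h, Submodule.mem_bot] at hr
  rw [hr, map_zero, mul_one] at hr'
  exact absurd hr'.symm (by simp)

theorem ringKrullDim_eq_one (hR : IsSemigroupRing K H R) : ringKrullDim R = 1 :=
  have := hR.isLocalRing
  have := hR.isDomain
  ringKrullDim_eq_one_iff_of_isLocalRing_isDomain.mpr ⟨hR.not_isField, fun y hy =>
    maximalIdeal_le_radical_of_isFiniteLength (hR.isFiniteLength_quotient_span y hy)⟩

end IsSemigroupRing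

end PowerSeries

/-! ## The residue pairing on `K[[t]]` and the canonical fractional ideal -/

section Perp

variable {K : Type u} [Field K] {H : AddSubmonoid ℕ} {R : Type u} [CommRing R]
  [Algebra R (PowerSeries K)]

/-- The orthogonal complement of a submodule of `K[[t]]` for the pairing
`(f, g) ↦ coeff n (f * g)`. -/
def coeffPerp (n : ℕ) (M : Submodule R (PowerSeries K)) : Submodule R (PowerSeries K) where
  carrier := {f | ∀ g ∈ M, PowerSeries.coeff n (f * g) = 0}
  zero_mem' := by simp
  add_mem' hf hg x hx := by rw [add_mul, map_add, hf x hx, hg x hx, add_zero]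
  smul_mem' r f hf x hx := by
    rw [smul_mul_assoc, ← mul_smul_comm]
    exact hf _ (M.smul_mem r hx)

theorem mem_coeffPerp {n : ℕ} {M : Submodule R (PowerSeries K)} {f : PowerSeries K} :
    f ∈ coeffPerp n M ↔ ∀ g ∈ M, PowerSeries.coeff n (f * g) = 0 :=
  Iff.rfl

/-- Perfectness of the pairing on `K[[t]]/t^(n+1)`: the coefficient of `g` at `j` is the value of
the functional on the dual monomial `t^(n-j)`. -/
theorem exists_forall_eq_coeff_mul {n : ℕ} {φ : PowerSeries K →ₗ[K] K}
    (hφ : ∀ f, φ (PowerSeries.X ^ (n + 1) * f) = 0) :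
    ∃ g, ∀ f, PowerSeries.coeff n (f * g) = φ f := by
  refine ⟨PowerSeries.mk fun j => φ (PowerSeries.X ^ (n - j)), fun h => ?_⟩
  obtain ⟨h', hh'⟩ := PowerSeries.exists_eq_sum_add_X_pow_mul (n + 1) h
  conv_rhs => rw [hh', map_add, hφ, add_zero, map_sum]
  rw [PowerSeries.coeff_mul, Finset.Nat.sum_antidiagonal_eq_sum_range_succ_mk]
  refine Finset.sum_congr rfl fun i hi => ?_
  rw [PowerSeries.coeff_mk, map_smul, smul_eq_mul,
    Nat.sub_sub_self (Nat.lt_succ_iff.mp (Finset.mem_range.mp hi))]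

/-- Biduality: a point outside `M` is separated from `M` by a `K`-functional, which kills `t^(n+1)
K[[t]] ⊆ M` and is therefore the pairing with an element of the orthogonal of `M`. -/
theorem mem_of_forall_coeffPerp [Algebra K R] [IsScalarTower K R (PowerSeries K)] {n : ℕ}
    {M : Submodule R (PowerSeries K)} (hM : ∀ f, PowerSeries.X ^ (n + 1) * f ∈ M)
    {f : PowerSeries K} (hf : ∀ g ∈ coeffPerp n M, PowerSeries.coeff n (f * g) = 0) : f ∈ M := by
  by_contra hfM
  obtain ⟨φ, hφf, hφM⟩ := Submodule.exists_le_ker_of_notMem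
    (p := M.restrictScalars K) (v := f) hfM
  obtain ⟨g₀, key⟩ := exists_forall_eq_coeff_mul (n := n) (φ := φ) fun h => hφM (hM h)
  refine hφf ?_
  rw [← key f]
  refine hf _ fun g hg => ?_
  rw [mul_comm, key]
  exact hφM hg

theorem coeffPerp_coeffPerp [Algebra K R] [IsScalarTower K R (PowerSeries K)] {n : ℕ}
    {M : Submodule R (PowerSeries K)} (hM : ∀ f, PowerSeries.X ^ (n + 1) * f ∈ M) :
    coeffPerp n (coeffPerp n M) = M := by
  refine le_antisymm (fun f hf => mem_of_forall_coeffPerp hM hf) fun f hf g hg => ?_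
  rw [mul_comm]
  exact hg f hf

/-- The canonical fractional ideal of `K[[H]]`, where `F` is the Frobenius number of `H`. -/
noncomputable def canonicalSubmodule (K : Type u) [Field K] (R : Type u) [CommRing R]
    [Algebra R (PowerSeries K)] (F : ℕ) : Submodule R (PowerSeries K) :=
  coeffPerp F (LinearMap.range (Algebra.linearMap R (PowerSeries K)))

theorem mem_canonicalSubmodule {F : ℕ} {f : PowerSeries K} : f ∈ canonicalSubmodule K R F ↔
    ∀ r : R, PowerSeries.coeff F (f * algebraMap R (PowerSeries K) r) = 0 := by
  rw [canonicalSubmodule, mem_coeffPerp]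
  constructor
  · intro h r; exact h _ ⟨r, rfl⟩
  · rintro h _ ⟨r, rfl⟩; exact h r

namespace IsSemigroupRing

variable [Algebra K R]

theorem exists_algebraMap_eq_X_pow (hR : IsSemigroupRing K H R) {h : ℕ} (hh : h ∈ H) :
    ∃ r : R, algebraMap R (PowerSeries K) r = PowerSeries.X ^ h := by
  rw [hR.mem_range_iff]
  intro n hn
  rw [PowerSeries.coeff_X_pow, if_neg]
  rintro rfl
  exact hn hh

theorem mem_canonicalSubmodule_iff (hR : IsSemigroupRing K H R) {F : ℕ} {f : PowerSeries K} :
    f ∈ canonicalSubmodule K R F ↔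
    ∀ i j : ℕ, i + j = F → j ∈ H → PowerSeries.coeff i f = 0 := by
  rw [mem_canonicalSubmodule]
  constructor
  · rintro h i j rfl hj
    obtain ⟨r, hr⟩ := hR.exists_algebraMap_eq_X_pow hj
    have := h r
    rwa [hr, PowerSeries.coeff_mul_X_pow] at this
  · intro h r
    rw [PowerSeries.coeff_mul]
    refine Finset.sum_eq_zero fun p hp => ?_
    by_cases hpH : p.2 ∈ H
    · rw [h p.1 p.2 (Finset.HasAntidiagonal.mem_antidiagonal.mp hp) hpH, zero_mul]
    · rw [hR.coeff_eq_zero r hpH, mul_zero]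

/-- A fractional ideal of type one is, up to multiplication by an element, the canonical
fractional ideal. -/
theorem exists_eq_mul_canonicalSubmodule (hR : IsSemigroupRing K H R) [IsLocalRing R] {F : ℕ}
    (hF : F ∉ H)
    (hF' : ∀ n, F < n → n ∈ H) {M : Submodule R (PowerSeries K)} (hM : M ≠ ⊥) {c : ℕ} (hc0 : 0 < c)
    (hc : ∀ n, c ≤ n → n ∈ H) (hMc : ∀ f ∈ M, PowerSeries.X ^ c ∣ f)
    (htype : ∀ w w' : PowerSeries K, (∀ a ∈ IsLocalRing.maximalIdeal R, a • w ∈ M) →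
      (∀ a ∈ IsLocalRing.maximalIdeal R, a • w' ∈ M) → w ∉ M → ∃ r : R, w' - r • w ∈ M) :
    ∃ v : PowerSeries K, v ≠ 0 ∧ ∀ f, f ∈ M ↔ ∃ g ∈ canonicalSubmodule K R F, f = v * g := by
  have := hR.tower
  have := hR.isNoetherian
  obtain ⟨N, hN⟩ := hR.exists_X_pow_mul_mem hM
  -- Beyond `N`, so that `M` contains `t^(n+1) K[[t]]` and biduality applies; beyond `F` and `c`, so
  -- that the subtractions below are genuine.
  obtain ⟨n, hnN, hnF, hnc⟩ : ∃ n, N ≤ n ∧ F ≤ n ∧ c ≤ n :=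
    ⟨N + F + c, by omega, by omega, by omega⟩
  have hMn : ∀ f, PowerSeries.X ^ (n + 1) * f ∈ M := fun f => by
    rw [show n + 1 = N + (n + 1 - N) by omega, pow_add, mul_assoc]
    exact hN _
  set I := coeffPerp n M with hI
  have hIM : coeffPerp n I = M := coeffPerp_coeffPerp hMn
  set m := IsLocalRing.maximalIdeal R
  have hIX : ∀ f, PowerSeries.X ^ (n + 1 - c) * f ∈ I := by
    intro f g hg
    obtain ⟨g', rfl⟩ := hMc g hg
    rw [mul_mul_mul_comm, ← pow_add, Nat.sub_add_cancel (by omega), PowerSeries.coeff_X_pow_mul',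
      if_neg (by omega)]
  -- This is where `M ⊆ t^c K[[t]]` is used: `I` contains `t^(n+1-c) K[[t]]` and `t^c ∈ 𝔪`, so
  -- biduality applies to `𝔪I` as well.
  have hAX : ∀ f, PowerSeries.X ^ (n + 1) * f ∈ m • I := by
    intro f
    obtain ⟨r, hr, hr'⟩ := hR.exists_mem_maximalIdeal_eq_X_pow_mul hc0 hc 1
    have : PowerSeries.X ^ (n + 1) * f = r • (PowerSeries.X ^ (n + 1 - c) * f) := by
      rw [Algebra.smul_def, hr', mul_one, ← mul_assoc, ← pow_add]
      congr 2; omega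
    rw [this]
    exact Submodule.smul_mem_smul hr (hIX f)
  -- The orthogonal of `𝔪I` is the colon `M : 𝔪`.
  have hA : ∀ w, w ∈ coeffPerp n (m • I) ↔ ∀ a ∈ m, a • w ∈ M := by
    intro w
    constructor
    · intro hw a ha
      rw [← hIM]
      intro g hg
      rw [smul_mul_assoc, ← mul_smul_comm]
      exact hw _ (Submodule.smul_mem_smul ha hg)
    · intro hw g hg
      refine Submodule.smul_induction_on hg (fun a ha x hx => ?_) fun x y hx hy => ?_
      · rw [mul_smul_comm, ← smul_mul_assoc, mul_comm]
        exact hx _ (hw a ha)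
      · rw [mul_add, map_add, hx, hy, add_zero]
  have hne : I ≤ m • I → False := by
    intro h
    have h0 := Submodule.eq_bot_of_le_smul_of_le_jacobson_bot m I (IsNoetherian.noetherian I) h
      (IsLocalRing.maximalIdeal_le_jacobson ⊥)
    have := hIX 1
    rw [h0, Submodule.mem_bot, mul_one] at this
    simp at this
  have hTM : ∃ w, (∀ a ∈ m, a • w ∈ M) ∧ w ∉ M := by
    by_contra! hcon
    refine hne fun f hf => mem_of_forall_coeffPerp hAX fun g hg => ?_
    exact hf g (hcon g ((hA g).mp hg))
  obtain ⟨w, hw, hwM⟩ := hTM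
  -- By type one, `M : 𝔪 = M + Rw`, and `𝔪w ⊆ M` reduces `Rw` to `Kw`. So `𝔪I` is cut out of `I` by
  -- one linear condition.
  have hmem : ∀ f ∈ I, PowerSeries.coeff n (f * w) = 0 → f ∈ m • I := by
    intro f hf hfw
    refine mem_of_forall_coeffPerp hAX fun g hg => ?_
    obtain ⟨r, hr⟩ := htype w g hw ((hA g).mp hg) hwM
    have h1 := hf _ hr
    set x := PowerSeries.constantCoeff (algebraMap R (PowerSeries K) r)
    have hx : r - algebraMap K R x ∈ m := by
      rw [hR.mem_maximalIdeal_iff, map_sub, ← IsScalarTower.algebraMap_apply, map_sub]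
      simp [x]
    have h2 := hf _ (hw _ hx)
    rw [sub_smul, algebraMap_smul, mul_sub, map_sub, mul_smul_comm x, map_smul, hfw, smul_zero,
      sub_zero] at h2
    rwa [mul_sub, map_sub, h2, sub_zero] at h1
  obtain ⟨u, huI, huw⟩ : ∃ u ∈ I, PowerSeries.coeff n (u * w) ≠ 0 := by
    by_contra! hcon
    exact hne fun f hf => hmem f hf (hcon f hf)
  -- Nakayama: subtracting a scalar multiple of `u` from `f ∈ I` lands in `𝔪I`.
  have hIu : I ≤ Submodule.span R {u} := by
    refine Submodule.le_of_le_smul_of_le_jacobson_bot (IsNoetherian.noetherian I)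
      (IsLocalRing.maximalIdeal_le_jacobson ⊥) fun f hf => ?_
    set x := PowerSeries.coeff n (f * w) / PowerSeries.coeff n (u * w)
    have hfu : f - x • u ∈ m • I := by
      have hxu : x • u ∈ I := by
        rw [← algebraMap_smul R x u]; exact I.smul_mem _ huI
      refine hmem _ (I.sub_mem hf hxu) ?_
      rw [sub_mul, map_sub, smul_mul_assoc, map_smul, smul_eq_mul, div_mul_cancel₀ _ huw, sub_self]
    rw [← add_sub_cancel (x • u) f]
    refine Submodule.add_mem_sup ?_ hfu
    rw [← algebraMap_smul R x u]
    exact Submodule.smul_mem _ _ (Submodule.mem_span_singleton_self u)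
  have hMu : ∀ f, f ∈ M ↔ ∀ r : R, PowerSeries.coeff n (f * u * algebraMap R _ r) = 0 := by
    intro f
    rw [← hIM]
    constructor
    · intro hf r
      have := hf (r • u) (I.smul_mem r huI)
      rwa [Algebra.smul_def, mul_comm (algebraMap R _ r), ← mul_assoc] at this
    · intro hf g hg
      obtain ⟨r, rfl⟩ := Submodule.mem_span_singleton.mp (hIu hg)
      rw [Algebra.smul_def, mul_comm (algebraMap R _ r), ← mul_assoc]
      exact hf r
  -- If the order `d` of `u` exceeded `n - F`, then `t^(d+F)` would lie in `I = Ru`, so `R` would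
  -- contain a unit times `t^F`, contrary to `F ∉ H`.
  obtain ⟨v, hv⟩ : u ∣ PowerSeries.X ^ (n - F) := by
    have hu0 : u ≠ 0 := by rintro rfl; simp at huw
    obtain ⟨d, v, hdv, hv0⟩ := PowerSeries.exists_X_pow_eq_mul hu0
    by_cases hd : d ≤ n - F
    · refine ⟨v * PowerSeries.X ^ (n - F - d), ?_⟩
      rw [← mul_assoc, mul_comm u, ← hdv, ← pow_add]
      congr 1; omega
    · exfalso
      obtain ⟨r, hr⟩ := Submodule.mem_span_singleton.mp
        (hIu (hIX (PowerSeries.X ^ (d + F - (n + 1 - c)) : PowerSeries K)))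
      rw [← pow_add, Nat.add_sub_cancel' (by omega), Algebra.smul_def] at hr
      have hv : v * PowerSeries.X ^ F = algebraMap R _ r := by
        refine mul_right_cancel₀ hu0 ?_
        rw [hr, pow_add, hdv]; ring
      have h0 := hR.coeff_eq_zero r hF
      rw [← hv] at h0
      have := PowerSeries.coeff_mul_X_pow v F 0
      rw [zero_add, h0] at this
      exact hv0 (by rw [← PowerSeries.coeff_zero_eq_constantCoeff_apply]; exact this.symm)
  have hu0 : u ≠ 0 := by rintro rfl; simp at huw
  have hXn : ∀ g : PowerSeries K, PowerSeries.coeff n (PowerSeries.X ^ (n - F) * g) =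
      PowerSeries.coeff F g := fun g => by
    rw [PowerSeries.coeff_X_pow_mul', if_pos (by omega), Nat.sub_sub_self hnF]
  refine ⟨v, by rintro rfl; simp at hv, fun f => ?_⟩
  rw [hMu]
  constructor
  · intro hf
    -- For `j < n - F` the exponent `n - j` exceeds `F`, so `t^(n-j) ∈ R` and pairing with it kills
    -- the coefficient at `j`.
    obtain ⟨g, hg⟩ : PowerSeries.X ^ (n - F) ∣ f * u := by
      rw [PowerSeries.X_pow_dvd_iff]
      intro j hj
      obtain ⟨r, hr⟩ := hR.exists_algebraMap_eq_X_pow (hF' (n - j) (by omega))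
      have := hf r
      rwa [hr, PowerSeries.coeff_mul_X_pow', if_pos (by omega), Nat.sub_sub_self (by omega)] at this
    refine ⟨g, mem_canonicalSubmodule.mpr fun r => ?_, ?_⟩
    · rw [← hXn, ← mul_assoc, ← hg]
      exact hf r
    · refine mul_right_cancel₀ hu0 ?_
      rw [hg, hv]; ring
  · rintro ⟨g, hg, rfl⟩ r
    rw [show v * g * u * algebraMap R (PowerSeries K) r = (u * v) * (g * algebraMap R _ r) by ring,
      ← hv, hXn]
    exact mem_canonicalSubmodule.mp hg r

end IsSemigroupRing

end Perp

/-! ## The canonical fractional ideal has injective dimension at most one -/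

/-- A map from a nonzero ideal to `L` is determined by its value at one nonzero `a`: it is `x ↦ x *
g(a) / a`. -/
theorem Module.Baer.of_field {R L : Type*} [CommRing R] [Field L] [Algebra R L]
    (h : Function.Injective (algebraMap R L)) : Module.Baer R L := by
  intro I g
  by_cases hI : I = ⊥
  · subst hI
    exact ⟨0, fun x hx => by
      obtain rfl : x = 0 := hx
      rw [map_zero]; exact (map_zero g).symm⟩
  · obtain ⟨a, ha, ha0⟩ := Submodule.exists_mem_ne_zero_of_ne_bot hI
    have ha0' : algebraMap R L a ≠ 0 := fun h0 => ha0 (h (by rw [h0, map_zero]))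
    refine ⟨LinearMap.toSpanSingleton R L ((algebraMap R L a)⁻¹ * g ⟨a, ha⟩), fun x hx => ?_⟩
    have h1 : a • g ⟨x, hx⟩ = x • g ⟨a, ha⟩ := by
      rw [← map_smul, ← map_smul]
      congr 1
      exact Subtype.ext (mul_comm a x)
    rw [LinearMap.toSpanSingleton_apply, Algebra.smul_def, mul_left_comm, ← Algebra.smul_def x,
      ← h1, Algebra.smul_def, inv_mul_cancel_left₀ ha0']

section Laurent

variable {K : Type u} [Field K]

theorem laurent_coeff_coe_eq_zero {N : ℕ} {f : PowerSeries K} (hf : PowerSeries.X ^ N ∣ f) {i : ℤ}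
    (hi : i < N) : (HahnSeries.ofPowerSeries ℤ K f).coeff i = 0 := by
  rw [PowerSeries.coeff_coe]
  split_ifs with h
  · rfl
  · exact PowerSeries.X_pow_dvd_iff.mp hf _ (by omega)

theorem laurent_coeff_mul_eq_zero (q : LaurentSeries K) (i : ℤ) :
    ∃ N : ℕ, ∀ f, PowerSeries.X ^ N ∣ f → (q * HahnSeries.ofPowerSeries ℤ K f).coeff i = 0 := by
  refine ⟨(i - q.order).toNat + 1, fun f hf => ?_⟩
  conv_lhs => rw [← LaurentSeries.single_order_mul_powerSeriesPart q]
  rw [mul_assoc, ← map_mul, HahnSeries.coeff_single_mul, one_mul]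
  exact laurent_coeff_coe_eq_zero (hf.mul_left _) (by push_cast; omega)

variable {H : AddSubmonoid ℕ} {R : Type u} [CommRing R]
  [Algebra R (PowerSeries K)] [Algebra R (LaurentSeries K)]
  [IsScalarTower R (PowerSeries K) (LaurentSeries K)]

/-- The canonical fractional ideal, inside the field of Laurent series. -/
noncomputable def canonicalLaurent (K : Type u) [Field K] (R : Type u) [CommRing R]
    [Algebra R (LaurentSeries K)] (F : ℤ) : Submodule R (LaurentSeries K) where
  carrier := {q | ∀ r : R, (r • q).coeff F = 0}
  zero_mem' := by simp
  add_mem' hp hq r := by rw [smul_add, HahnSeries.coeff_add, hp r, hq r, add_zero]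
  smul_mem' s q hq r := by rw [smul_smul]; exact hq _

theorem smul_laurent_eq (r : R) (q : LaurentSeries K) :
    r • q = q * HahnSeries.ofPowerSeries ℤ K (algebraMap R (PowerSeries K) r) := by
  rw [Algebra.smul_def, IsScalarTower.algebraMap_apply R (PowerSeries K) (LaurentSeries K),
    mul_comm]
  rfl

/-- Functionals on `K[[t]]` killing a power of `t` restrict to `R` as residue pairings with a
Laurent series; the factor `t^(F-N)` moves the coefficient read off from `N` to `F`. -/
theorem exists_eq_coeff_smul_of_dvd {N : ℕ} {Ψ : PowerSeries K →ₗ[K] K}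
    (hΨ : ∀ f, PowerSeries.X ^ (N + 1) ∣ f → Ψ f = 0) (F : ℤ) :
    ∃ q : LaurentSeries K, ∀ r : R, (r • q).coeff F = Ψ (algebraMap R (PowerSeries K) r) := by
  obtain ⟨g, hg⟩ := exists_forall_eq_coeff_mul (n := N) (φ := Ψ) fun f => hΨ _ ⟨f, rfl⟩
  refine ⟨HahnSeries.single (F - N) 1 * HahnSeries.ofPowerSeries ℤ K g, fun r => ?_⟩
  rw [smul_laurent_eq, mul_assoc, ← map_mul, HahnSeries.coeff_single_mul, one_mul, sub_sub_cancel,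
    HahnSeries.ofPowerSeries_apply_coeff, mul_comm, hg]

/-- Taking the coefficient at `F` makes the quotient the continuous `K`-dual of `R`, so a map out of
an ideal `I` amounts to a `K`-functional on `I`. Such a functional extends to `R` by linear algebra;
continuity comes from `I ≠ 0`. -/
theorem IsSemigroupRing.baer_laurent_quotient [Algebra K R] (hR : IsSemigroupRing K H R) (F : ℤ) :
    Module.Baer R (LaurentSeries K ⧸ canonicalLaurent K R F) := by
  intro I g
  have := hR.tower
  by_cases hI : I = ⊥
  · subst hI
    exact ⟨0, fun x hx => by
      obtain rfl : x = 0 := hx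
      rw [map_zero]; exact (map_zero g).symm⟩
  have hl : ∀ {p q : LaurentSeries K},
      (Submodule.Quotient.mk p : LaurentSeries K ⧸ canonicalLaurent K R F) =
        Submodule.Quotient.mk q → p.coeff F = q.coeff F := by
    intro p q hpq
    have := (Submodule.Quotient.eq _).mp hpq 1
    rwa [one_smul, HahnSeries.coeff_sub, sub_eq_zero] at this
  choose s hs using Submodule.mkQ_surjective (canonicalLaurent K R F)
  have hs' : ∀ x, (Submodule.Quotient.mk (s x) : LaurentSeries K ⧸ canonicalLaurent K R F) = x := hs
  have hsmul : ∀ (x : K) (q : LaurentSeries K), algebraMap K R x • q = x • q := by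
    intro x q
    rw [smul_laurent_eq, ← IsScalarTower.algebraMap_apply, ← PowerSeries.C_eq_algebraMap,
      HahnSeries.ofPowerSeries_C, mul_comm, HahnSeries.C_mul_eq_smul]
  let ψ₀ : I.restrictScalars K →ₗ[K] K :=
    { toFun a := (s (g a)).coeff F
      map_add' a b := by
        rw [← HahnSeries.coeff_add]
        apply hl
        rw [Submodule.Quotient.mk_add, hs', hs', hs']
        exact map_add g a b
      map_smul' x a := by
        rw [RingHom.id_apply, ← HahnSeries.coeff_smul]
        apply hl
        rw [← hsmul, Submodule.Quotient.mk_smul, hs', hs']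
        have h1 : (g ((algebraMap K R x) • (⟨a.1, a.2⟩ : I)) :
            LaurentSeries K ⧸ canonicalLaurent K R F) = algebraMap K R x • g ⟨a.1, a.2⟩ :=
          map_smul g _ _
        refine Eq.trans (congrArg g (Subtype.ext ?_)) h1
        exact (algebraMap_smul R x (a.1 : R)).symm }
  obtain ⟨ψ, hψ⟩ := LinearMap.exists_extend ψ₀
  have hinj : LinearMap.ker (IsScalarTower.toAlgHom K R (PowerSeries K)).toLinearMap = ⊥ :=
    LinearMap.ker_eq_bot.mpr hR.injective
  -- A `K`-linear retraction of `R ⊆ K[[t]]`, which carries the functional over to `K[[t]]`.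
  obtain ⟨ρ, hρ⟩ := LinearMap.exists_leftInverse_of_injective _ hinj
  have hρ' : ∀ r : R, ρ (algebraMap R _ r) = r := fun r => LinearMap.congr_fun hρ r
  obtain ⟨c, -, hc⟩ := hR.numerical.exists_conductor
  obtain ⟨a, ha, ha0⟩ := Submodule.exists_mem_ne_zero_of_ne_bot hI
  have ha0' : algebraMap R (PowerSeries K) a ≠ 0 :=
    fun h0 => ha0 (hR.injective (by rw [h0, map_zero]))
  obtain ⟨d, v, hv, -⟩ := PowerSeries.exists_X_pow_eq_mul ha0'
  obtain ⟨N, hN⟩ := laurent_coeff_mul_eq_zero (s (g ⟨a, ha⟩)) F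
  -- Continuity: such an `f` equals `r * a` with `r` divisible by `t^(N+1)`. By linearity the
  -- functional takes there the value `coeff F` of `r` times a lift of `g(a)`, which is zero by the
  -- choice of `N`.
  have hΨ : ∀ f, PowerSeries.X ^ (N + c + d + 1) ∣ f → (ψ ∘ₗ ρ) f = 0 := by
    rintro _ ⟨f, rfl⟩
    obtain ⟨r, hr⟩ := hR.exists_eq_X_pow_mul hc (PowerSeries.X ^ (N + 1) * f * v)
    have hra : algebraMap R (PowerSeries K) (r * a) = PowerSeries.X ^ (N + c + d + 1) * f := by
      rw [map_mul, hr, show N + c + d + 1 = c + (N + 1) + d by ring, pow_add, pow_add, hv]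
      ring
    rw [← hra, LinearMap.comp_apply, hρ']
    have h1 : ψ (r * a) = ψ₀ ⟨r * a, I.mul_mem_left r ha⟩ :=
      LinearMap.congr_fun hψ ⟨r * a, I.mul_mem_left r ha⟩
    rw [h1]
    have h2 : (s (g ⟨r * a, I.mul_mem_left r ha⟩)).coeff F = (r • s (g ⟨a, ha⟩)).coeff F := by
      apply hl
      rw [Submodule.Quotient.mk_smul, hs', hs', ← map_smul]
      rfl
    change (s (g ⟨r * a, I.mul_mem_left r ha⟩)).coeff F = 0
    rw [h2, smul_laurent_eq]
    refine hN _ ?_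
    rw [hr, pow_succ]
    exact ⟨PowerSeries.X ^ c * (PowerSeries.X * f * v), by ring⟩
  obtain ⟨q, hq⟩ := exists_eq_coeff_smul_of_dvd (R := R) hΨ F
  refine ⟨LinearMap.toSpanSingleton R _ (Submodule.Quotient.mk q), fun x hx => ?_⟩
  rw [LinearMap.toSpanSingleton_apply, ← hs' (g ⟨x, hx⟩), ← Submodule.Quotient.mk_smul,
    Submodule.Quotient.eq]
  intro r
  rw [smul_sub, HahnSeries.coeff_sub, sub_eq_zero, smul_smul, hq, LinearMap.comp_apply, hρ']
  have h1 : ψ (r * x) = ψ₀ ⟨r * x, I.mul_mem_left r hx⟩ :=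
    LinearMap.congr_fun hψ ⟨r * x, I.mul_mem_left r hx⟩
  rw [h1]
  apply hl
  rw [Submodule.Quotient.mk_smul, hs', hs', ← map_smul]
  rfl

/-- For `i < 0` the exponent `F - i` lies in `H`, and pairing with that monomial kills the
coefficient at `i`; so there is no polar part. -/
theorem IsSemigroupRing.exists_eq_of_mem_canonicalLaurent [Algebra K R]
    (hR : IsSemigroupRing K H R) {F : ℕ} (hF : ∀ n, F < n → n ∈ H) {q : LaurentSeries K}
    (hq : q ∈ canonicalLaurent K R F) :
    ∃ f ∈ canonicalSubmodule K R F, HahnSeries.ofPowerSeries ℤ K f = q := by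
  have hneg : ∀ i : ℤ, i < 0 → q.coeff i = 0 := by
    intro i hi
    obtain ⟨h, hh⟩ : ∃ h : ℕ, (h : ℤ) = F - i := ⟨(F - i).toNat, by omega⟩
    obtain ⟨r, hr⟩ := hR.exists_algebraMap_eq_X_pow (hF h (by omega))
    have := hq r
    rwa [smul_laurent_eq, hr, HahnSeries.ofPowerSeries_X_pow, HahnSeries.coeff_mul_single,
      mul_one, hh, sub_sub_cancel] at this
  have hfq : HahnSeries.ofPowerSeries ℤ K (PowerSeries.mk fun n => q.coeff n) = q := by
    ext i
    rw [PowerSeries.coeff_coe]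
    split_ifs with hi
    · exact (hneg i hi).symm
    · rw [PowerSeries.coeff_mk, Int.natAbs_of_nonneg (by omega)]
  refine ⟨_, mem_canonicalSubmodule.mpr fun r => ?_, hfq⟩
  have := hq r
  rwa [smul_laurent_eq, ← hfq, ← map_mul, HahnSeries.ofPowerSeries_apply_coeff] at this

end Laurent

/-- Both `K((t))` and `K((t))/ω` are injective, the first as a field containing `R`, the second by
duality. -/
theorem IsSemigroupRing.hasInjectiveDimensionLE_canonicalSubmodule {K : Type u} [Field K]
    {H : AddSubmonoid ℕ} {R : Type u} [CommRing R] [Algebra K R] [Algebra R (PowerSeries K)]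
    (hR : IsSemigroupRing K H R) {F : ℕ} (hF : ∀ n, F < n → n ∈ H) :
    HasFiniteInjectiveDimension R (canonicalSubmodule K R F) := by
  let : Algebra R (LaurentSeries K) :=
    ((algebraMap (PowerSeries K) (LaurentSeries K)).comp (algebraMap R (PowerSeries K))).toAlgebra
  have : IsScalarTower R (PowerSeries K) (LaurentSeries K) := IsScalarTower.of_algebraMap_eq' rfl
  have hVL : Function.Injective (HahnSeries.ofPowerSeries ℤ K) := HahnSeries.ofPowerSeries_injective
  let ι : canonicalSubmodule K R F →ₗ[R] LaurentSeries K :=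
    (IsScalarTower.toAlgHom R (PowerSeries K) (LaurentSeries K)).toLinearMap ∘ₗ
      (canonicalSubmodule K R F).subtype
  have hι : Function.Injective ι := hVL.comp Subtype.val_injective
  have hrange : LinearMap.range ι = canonicalLaurent K R F := by
    ext q
    constructor
    · rintro ⟨f, rfl⟩ r
      have := mem_canonicalSubmodule.mp f.2 r
      rw [smul_laurent_eq]
      change (HahnSeries.ofPowerSeries ℤ K f * _).coeff _ = 0
      rw [← map_mul, HahnSeries.ofPowerSeries_apply_coeff, this]
    · intro hq
      obtain ⟨f, hf, hfq⟩ := hR.exists_eq_of_mem_canonicalLaurent hF hq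
      exact ⟨⟨f, hf⟩, hfq⟩
  have hex : Function.Exact ι (canonicalLaurent K R F).mkQ := by
    rw [← hrange]; exact LinearMap.exact_map_mkQ_range ι
  have hS := exact_shortExact hι (Submodule.mkQ_surjective _) hex
  have hinj : Function.Injective (algebraMap R (LaurentSeries K)) := hVL.comp hR.injective
  have i2 : Injective (ModuleCat.of R (LaurentSeries K)) :=
    (Module.injective_iff_injective_object R _).mp (Module.Baer.of_field hinj).injective
  have i3 : Injective (ModuleCat.of R (LaurentSeries K ⧸ canonicalLaurent K R F)) :=
    (Module.injective_iff_injective_object R _).mp (hR.baer_laurent_quotient F).injective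
  refine ⟨1, (hS.hasInjectiveDimensionLT_X₃_iff 0 i2).mp ?_⟩
  exact injective_iff_hasInjectiveDimensionLT_one.mp i3

/-! ## Modules of type one inside an overring -/

theorem Module.surjective_of_injective_of_length_le {A M N : Type*} [Ring A] [AddCommGroup M]
    [Module A M] [AddCommGroup N] [Module A N] {f : M →ₗ[A] N} (hf : Function.Injective f)
    (hM : IsFiniteLength A M) (hl : Module.length A N ≤ Module.length A M) :
    Function.Surjective f := by
  have h := Module.length_eq_add_of_exact f (LinearMap.range f).mkQ hf
    (Submodule.mkQ_surjective _) (LinearMap.exact_map_mkQ_range f)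
  rw [h] at hl
  have hne : Module.length A M ≠ ⊤ := Module.length_ne_top_iff.mpr hM
  have h0 : Module.length A (N ⧸ LinearMap.range f) = 0 := by
    exact le_antisymm ((ENat.add_le_add_iff_left hne).mp (hl.trans (add_zero _).ge)) bot_le
  rw [Module.length_eq_zero_iff, Submodule.Quotient.subsingleton_iff] at h0
  exact LinearMap.range_eq_top.mp h0

section OverRing

variable {A R B : Type u} [CommRing A] [CommRing R] [IsLocalRing R] [CommRing B]
  [IsDomain B] [Algebra A R] [Algebra R B] [Algebra A B] [IsScalarTower A R B]

theorem exists_residueField_lift {X : Type*} [AddCommGroup X] [Module A X] (g : R →ₗ[A] X)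
    (hg : ∀ a ∈ IsLocalRing.maximalIdeal R, g a = 0) :
    ∃ g' : IsLocalRing.ResidueField R →ₗ[A] X, ∀ r, g' (IsLocalRing.residue R r) = g r := by
  let ρ : R →ₗ[A] IsLocalRing.ResidueField R :=
    (IsScalarTower.toAlgHom A R (IsLocalRing.ResidueField R)).toLinearMap
  have hρ : Function.Surjective ρ := IsLocalRing.residue_surjective
  refine ⟨(LinearMap.ker ρ).liftQ g ?_ ∘ₗ (ρ.quotKerEquivOfSurjective hρ).symm, fun r => ?_⟩
  · intro a ha
    exact hg a ((IsLocalRing.residue_eq_zero_iff a).mp ha)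
  · have : (ρ.quotKerEquivOfSurjective hρ).symm (IsLocalRing.residue R r) =
        Submodule.Quotient.mk r := by
      rw [LinearEquiv.symm_apply_eq]; rfl
    rw [LinearMap.comp_apply, LinearEquiv.coe_coe, this]
    rfl

/-- Type descends along `A → R`: the socle quotient `(N : 𝔪_R)/(N : R)` embeds in `Ext¹_A(k_R, N)`,
of length at most `ℓ_A(k_R)`. A socle element `w` outside `N : R` gives an injection of `k_R` into
it by `r ↦ rw`, which is then onto. It is used with `A = R` and with `A` a Gorenstein subring. -/
theorem exists_sub_smul_mem_of_length_ext_le_one [IsLocalRing A] [IsNoetherianRing A]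
    (N : Submodule A B)
    (hd : IsFiniteLength A (IsLocalRing.ResidueField R))
    (hden : ∃ a : A, algebraMap A R a ∈ IsLocalRing.maximalIdeal R ∧ algebraMap A B a ≠ 0)
    (h₁ : Module.length A (ModuleExt A (IsLocalRing.ResidueField A) N 1) ≤ 1) {w w' : B}
    (hw : ∀ a ∈ IsLocalRing.maximalIdeal R, a • w ∈ N)
    (hw' : ∀ a ∈ IsLocalRing.maximalIdeal R, a • w' ∈ N) (hwN : ¬ ∀ r : R, r • w ∈ N) :
    ∃ r : R, ∀ s : R, s • (w' - r • w) ∈ N := by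
  let ι : R →ₗ[A] B := (IsScalarTower.toAlgHom A R B).toLinearMap
  let J : Submodule A B := LinearMap.range ι
  let I : Submodule A B := ((IsLocalRing.maximalIdeal R).restrictScalars A).map ι
  have hI : ∀ q, q ∈ N / I ↔ ∀ a ∈ IsLocalRing.maximalIdeal R, a • q ∈ N := by
    intro q
    rw [Submodule.mem_div_iff_forall_mul_mem]
    constructor
    · intro h a ha
      rw [Algebra.smul_def, mul_comm]
      exact h _ ⟨a, ha, rfl⟩
    · rintro h _ ⟨a, ha, rfl⟩
      have := h a ha
      rwa [Algebra.smul_def, mul_comm] at this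
  have hJ : ∀ q, q ∈ N / J ↔ ∀ a : R, a • q ∈ N := by
    intro q
    rw [Submodule.mem_div_iff_forall_mul_mem]
    constructor
    · intro h a
      rw [Algebra.smul_def, mul_comm]
      exact h _ ⟨a, rfl⟩
    · rintro h _ ⟨a, rfl⟩
      have := h a
      rwa [Algebra.smul_def, mul_comm] at this
  obtain ⟨j, hj⟩ := exists_residueField_lift (A := A)
    ((I.submoduleOf J).mkQ ∘ₗ ι.rangeRestrict) (by
      intro a ha
      rw [LinearMap.comp_apply, Submodule.mkQ_apply, Submodule.Quotient.mk_eq_zero]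
      exact ⟨a, ha, rfl⟩)
  have hjs : Function.Surjective j := by
    intro y
    obtain ⟨⟨_, r, rfl⟩, rfl⟩ := Submodule.mkQ_surjective _ y
    exact ⟨IsLocalRing.residue R r, hj r⟩
  have hfin : IsFiniteLength A (↥J ⧸ I.submoduleOf J) := by
    rw [← Module.length_ne_top_iff] at hd ⊢
    exact ne_top_of_le_ne_top hd (Module.length_le_of_surjective j hjs)
  have hle : Module.length A (↥(N / I) ⧸ (N / J).submoduleOf (N / I)) ≤
      Module.length A (IsLocalRing.ResidueField R) := by
    refine (length_div_quotient_le N ?_).trans ((ModuleExt.length_le N hfin 1).trans ?_)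
    · rintro _ ⟨r, rfl⟩
      obtain ⟨a, ha, ha0⟩ := hden
      refine ⟨a, ha0, a • r, ?_, map_smul ι a r⟩
      change a • r ∈ IsLocalRing.maximalIdeal R
      rw [Algebra.smul_def]
      exact Ideal.mul_mem_right _ _ ha
    · exact (mul_le_mul' (Module.length_le_of_surjective j hjs) h₁).trans (mul_one _).le
  let φ : R →ₗ[A] ↥(N / I) ⧸ (N / J).submoduleOf (N / I) :=
    ((N / J).submoduleOf (N / I)).mkQ ∘ₗ
      { toFun r := ⟨r • w, (hI _).mpr fun a ha => by
          rw [smul_smul]; exact hw _ (Ideal.mul_mem_right _ _ ha)⟩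
        map_add' r s := Subtype.ext (add_smul r s w)
        map_smul' a r := Subtype.ext (smul_assoc a r w) }
  have hφ : ∀ r, φ r = 0 ↔ ∀ s : R, (s * r) • w ∈ N := by
    intro r
    rw [LinearMap.comp_apply, Submodule.mkQ_apply, Submodule.Quotient.mk_eq_zero]
    change r • w ∈ N / J ↔ _
    rw [hJ]
    simp only [smul_smul]
  obtain ⟨φ', hφ'⟩ := exists_residueField_lift φ (by
    intro a ha
    rw [hφ]
    exact fun s => hw _ (Ideal.mul_mem_left _ _ ha))
  have hinj : Function.Injective φ' := by
    rw [injective_iff_map_eq_zero]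
    intro y hy
    obtain ⟨r, rfl⟩ := IsLocalRing.residue_surjective y
    rw [hφ', hφ] at hy
    rw [IsLocalRing.residue_eq_zero_iff, IsLocalRing.mem_maximalIdeal]
    intro hu
    obtain ⟨v, hv⟩ := hu.exists_left_inv
    exact hwN fun s => by
      have := hy (s * v)
      rwa [mul_assoc, hv, mul_one] at this
  obtain ⟨y, hy⟩ := Module.surjective_of_injective_of_length_le hinj hd hle
    (Submodule.Quotient.mk ⟨w', (hI _).mpr hw'⟩)
  obtain ⟨r, rfl⟩ := IsLocalRing.residue_surjective y
  refine ⟨r, (hJ _).mp ?_⟩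
  rw [hφ', eq_comm] at hy
  exact (Submodule.Quotient.eq ((N / J).submoduleOf (N / I))).mp hy

end OverRing

/-! ## Invariance under isomorphism -/

section Congr

variable {A : Type u} [CommRing A] {N M M' : Type u} [AddCommGroup N] [AddCommGroup M]
  [AddCommGroup M'] [Module A N] [Module A M] [Module A M']

/-- `Ext` is invariant under isomorphism in the second variable. -/
noncomputable def ModuleExt.congrRight (N : Type u) [AddCommGroup N] [Module A N]
    (e : M ≃ₗ[A] M') (i : ℕ) : ModuleExt A N M i ≃ₗ[A] ModuleExt A N M' i :=
  have key {X Y : Type u} [AddCommGroup X] [AddCommGroup Y] [Module A X] [Module A Y]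
      (e : X ≃ₗ[A] Y) (x : ModuleExt A N X i) :
      (Ext.mk₀ (ModuleCat.ofHom e.symm.toLinearMap)).postcompOfLinear A (ModuleCat.of A N)
        (add_zero i) ((Ext.mk₀ (ModuleCat.ofHom e.toLinearMap)).postcompOfLinear A
          (ModuleCat.of A N) (add_zero i) x) = x := by
    change (x.comp (Ext.mk₀ (ModuleCat.ofHom _)) (add_zero i)).comp (Ext.mk₀ (ModuleCat.ofHom _))
      (add_zero i) = x
    rw [Ext.comp_assoc_of_second_deg_zero, Ext.mk₀_comp_mk₀, ← ModuleCat.ofHom_comp]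
    simp
  LinearEquiv.ofLinearMap
    ((Ext.mk₀ (ModuleCat.ofHom e.toLinearMap)).postcompOfLinear A (ModuleCat.of A N) (add_zero i))
    ((Ext.mk₀ (ModuleCat.ofHom e.symm.toLinearMap)).postcompOfLinear A (ModuleCat.of A N)
      (add_zero i))
    (LinearMap.ext fun x => key e.symm x) (LinearMap.ext fun x => key e x)

theorem HasFiniteInjectiveDimension.of_linearEquiv (e : M ≃ₗ[A] M')
    (h : HasFiniteInjectiveDimension A M) : HasFiniteInjectiveDimension A M' := by
  obtain ⟨n, hn⟩ := h
  exact ⟨n, (ModuleCat.hasInjectiveDimensionLE_iff_of_linearEquiv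
    (M := ModuleCat.of A M) (N := ModuleCat.of A M') e n).mp hn⟩

attribute [local instance] RingHomInvPair.of_ringEquiv in
theorem HasFiniteInjectiveDimension.of_ringEquiv {R S : Type u} [CommRing R] [CommRing S]
    (e : R ≃+* S) (h : HasFiniteInjectiveDimension R R) : HasFiniteInjectiveDimension S S := by
  obtain ⟨n, hn⟩ := h
  let e' : R ≃ₛₗ[RingHomClass.toRingHom e] S :=
    { e with map_smul' := fun a b => map_mul e a b }
  exact ⟨n, (ModuleCat.hasInjectiveDimensionLE_iff_of_semiLinearEquiv e
    (M := ModuleCat.of R R) (N := ModuleCat.of S S) e' n).mp hn⟩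

theorem isGorensteinRing_iff_of_isLocalRing {R : Type u} [CommRing R] [IsLocalRing R] :
    IsGorensteinRing R ↔ IsNoetherianRing R ∧ HasFiniteInjectiveDimension R R := by
  have key (m : Ideal R) [m.IsMaximal] : Nonempty (R ≃+* Localization.AtPrime m) := by
    refine ⟨(IsLocalization.atUnits R m.primeCompl (S := Localization.AtPrime m) ?_).toRingEquiv⟩
    intro x hx
    have hx' : x ∉ IsLocalRing.maximalIdeal R := by
      rw [← IsLocalRing.eq_maximalIdeal ‹m.IsMaximal›]
      exact hx
    exact not_not.mp hx'
  refine and_congr_right fun _ => ⟨fun h => ?_, fun h m hm => ?_⟩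
  · obtain ⟨e⟩ := key (IsLocalRing.maximalIdeal R)
    exact (h _).of_ringEquiv e.symm
  · obtain ⟨e⟩ := key m
    exact h.of_ringEquiv e

theorem moduleTrace_le_of_linearEquiv (e : M ≃ₗ[A] M') : moduleTrace A M ≤ moduleTrace A M' :=
  iSup_le fun f => by
    refine le_trans ?_ (le_iSup _ (f ∘ₗ e.symm.toLinearMap))
    rintro _ ⟨m, rfl⟩
    exact ⟨e m, by simp⟩

theorem moduleTrace_eq_of_linearEquiv (e : M ≃ₗ[A] M') : moduleTrace A M = moduleTrace A M' :=
  le_antisymm (moduleTrace_le_of_linearEquiv e) (moduleTrace_le_of_linearEquiv e.symm)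

theorem moduleTrace_self : moduleTrace A A = ⊤ :=
  top_le_iff.mp (le_trans (by rw [LinearMap.range_id]) (le_iSup _ LinearMap.id))

end Congr

/-! ## Canonical modules of `K[[H]]` -/

section Canonical

open PowerSeries

variable {K : Type u} [Field K] {H : AddSubmonoid ℕ} {R : Type u} [CommRing R] [Algebra K R]
  [Algebra R (PowerSeries K)]

namespace IsSemigroupRing

theorem exists_mem_maximalIdeal_ne_zero (hR : IsSemigroupRing K H R) [IsLocalRing R] :
    ∃ x ∈ IsLocalRing.maximalIdeal R, x ≠ 0 :=
  Submodule.exists_mem_ne_zero_of_ne_bot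
    fun h => hR.not_isField (IsLocalRing.isField_iff_maximalIdeal_eq.mpr h)

theorem algebraMap_ne_zero (hR : IsSemigroupRing K H R) {x : R} (hx : x ≠ 0) :
    algebraMap R (PowerSeries K) x ≠ 0 :=
  fun h => hx (hR.injective (by rw [h, map_zero]))

theorem subsingleton_ext_zero (hR : IsSemigroupRing K H R) [IsLocalRing R] {M : Type u}
    [AddCommGroup M] [Module R M] (f : M →ₗ[R] PowerSeries K) (hf : Function.Injective f) :
    Subsingleton (ModuleExt R (IsLocalRing.ResidueField R) M 0) := by
  obtain ⟨x, hxm, hx⟩ := hR.exists_mem_maximalIdeal_ne_zero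
  refine ModuleExt.subsingleton_zero_of_smul_injective M hxm fun m hm => hf ?_
  have := congrArg f hm
  rw [map_smul, map_zero, Algebra.smul_def] at this
  rw [map_zero]
  exact (mul_eq_zero.mp this).resolve_left (hR.algebraMap_ne_zero hx)

theorem isMaximalCohenMacaulay (hR : IsSemigroupRing K H R) [IsLocalRing R] {M : Type u}
    [AddCommGroup M] [Module R M] [Nontrivial M] (f : M →ₗ[R] PowerSeries K)
    (hf : Function.Injective f) : IsMaximalCohenMacaulay R M where
  nontrivial := inferInstance
  finite := by
    have := hR.isNoetherian
    have := isNoetherian_of_injective f hf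
    infer_instance
  ext_eq_zero i hi := by
    rw [hR.ringKrullDim_eq_one] at hi
    obtain rfl : i = 0 := by
      have : i < 1 := by exact_mod_cast hi
      omega
    exact hR.subsingleton_ext_zero f hf

theorem isCohenMacaulayLocalRing (hR : IsSemigroupRing K H R) [IsLocalRing R] :
    IsCohenMacaulayLocalRing R :=
  ⟨hR.isNoetherianRing, hR.isMaximalCohenMacaulay (Algebra.linearMap R _) hR.injective⟩

theorem nontrivial_canonicalSubmodule (hR : IsSemigroupRing K H R) (F : ℕ) :
    Nontrivial (canonicalSubmodule K R F) := by
  refine ⟨⟨0, ⟨X ^ (F + 1), ?_⟩, fun h => ?_⟩⟩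
  · rw [hR.mem_canonicalSubmodule_iff]
    rintro i j hij -
    rw [coeff_X_pow, if_neg (by omega)]
  · exact pow_ne_zero (F + 1) (X_ne_zero (R := K)) (congrArg Subtype.val h).symm

theorem exists_linearMap_of_conductor (hR : IsSemigroupRing K H R) {c : ℕ}
    (hc : ∀ n, c ≤ n → n ∈ H) :
    ∃ f : PowerSeries K →ₗ[R] R, ∀ g, algebraMap R (PowerSeries K) (f g) = X ^ c * g := by
  choose f hf using fun g => hR.exists_eq_X_pow_mul hc g
  refine ⟨{ toFun := f, map_add' := fun g h => hR.injective ?_,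
            map_smul' := fun r g => hR.injective ?_ }, hf⟩
  · rw [map_add, hf, hf, hf, mul_add]
  · rw [RingHom.id_apply, smul_eq_mul, map_mul, hf, hf, Algebra.smul_def, mul_left_comm]

/-- A module of finite injective dimension that embeds in the ring has type one. -/
theorem isCanonicalModule (hR : IsSemigroupRing K H R) [IsLocalRing R] {M : Type u}
    [AddCommGroup M] [Module R M] [Nontrivial M] (f : M →ₗ[R] PowerSeries K)
    (hf : Function.Injective f) (hM : HasFiniteInjectiveDimension R M) :
    IsCanonicalModule R M where
  isMaximalCohenMacaulay := hR.isMaximalCohenMacaulay f hf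
  type_eq_one := by
    have := hR.isDomain
    refine ⟨1, hR.ringKrullDim_eq_one, ?_⟩
    obtain ⟨x, hxm, hx⟩ := hR.exists_mem_maximalIdeal_ne_zero
    obtain ⟨c, -, hc⟩ := hR.numerical.exists_conductor
    -- Multiplication by `t^c` pushes the embedding into `K[[t]]` down into `R`.
    obtain ⟨g, hg⟩ := hR.exists_linearMap_of_conductor hc
    have hgf : Function.Injective (g ∘ₗ f) := by
      refine fun a b hab => hf ?_
      have := congrArg (algebraMap R (PowerSeries K)) hab
      rw [LinearMap.comp_apply, LinearMap.comp_apply, hg, hg] at this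
      exact mul_left_cancel₀ (pow_ne_zero c X_ne_zero) this
    exact ModuleExt.length_residueField_eq_one M (mem_nonZeroDivisors_of_ne_zero hx) hxm
      (hR.isFiniteLength_quotient_span x hx) hM (hR.subsingleton_ext_zero f hf)
      (length_quotient_lsmul_of_injective hR.isFiniteLength_quotient_span hgf hx)
  finite_injectiveDimension := hM

theorem isCanonicalModule_canonicalSubmodule (hR : IsSemigroupRing K H R) [IsLocalRing R] {F : ℕ}
    (hF : ∀ n, F < n → n ∈ H) : IsCanonicalModule R (canonicalSubmodule K R F) :=
  have := hR.nontrivial_canonicalSubmodule F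
  hR.isCanonicalModule (canonicalSubmodule K R F).subtype (Submodule.subtype_injective _)
    (hR.hasInjectiveDimensionLE_canonicalSubmodule hF)

/-- The canonical module of `K[[H]]` is unique up to isomorphism. -/
theorem nonempty_equiv_canonicalSubmodule (hR : IsSemigroupRing K H R) [IsLocalRing R] {F : ℕ}
    (hF : F ∉ H) (hF' : ∀ n, F < n → n ∈ H) {ω : Type u} [AddCommGroup ω] [Module R ω]
    (hω : IsCanonicalModule R ω) : Nonempty (ω ≃ₗ[R] canonicalSubmodule K R F) := by
  have := hR.isDomain
  have := hR.isNoetherianRing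
  have := hω.isMaximalCohenMacaulay.nontrivial
  have := hω.isMaximalCohenMacaulay.finite
  have h₀ := hω.isMaximalCohenMacaulay.ext_eq_zero 0 (by
    rw [hR.ringKrullDim_eq_one]; exact_mod_cast one_pos)
  obtain ⟨d, hd, h₁⟩ := hω.type_eq_one
  obtain rfl : d = 1 := by
    rw [hR.ringKrullDim_eq_one] at hd
    exact_mod_cast hd.symm
  obtain ⟨f, hf⟩ := exists_injective_of_length_ext_eq_one hR.isFiniteLength_quotient_span
    hR.not_isField h₀ h₁
  obtain ⟨c, hc0, hc⟩ := hR.numerical.exists_conductor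
  -- The factor `t^c` puts the image inside `t^c K[[t]]`, as `exists_eq_mul_canonicalSubmodule`
  -- requires.
  let g : ω →ₗ[R] PowerSeries K :=
    LinearMap.mulLeft R (X ^ c : PowerSeries K) ∘ₗ Algebra.linearMap R (PowerSeries K) ∘ₗ f
  have hg : Function.Injective g :=
    (mul_right_injective₀ (pow_ne_zero c X_ne_zero)).comp (hR.injective.comp hf)
  have hM : LinearMap.range g ≠ ⊥ := by
    intro h
    obtain ⟨m, hm⟩ := exists_ne (0 : ω)
    exact hm (hg (by rw [map_zero]; exact (Submodule.mem_bot R).mp (h ▸ ⟨m, rfl⟩)))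
  obtain ⟨x, hxm, hx⟩ := hR.exists_mem_maximalIdeal_ne_zero
  have hk : IsSimpleModule R (IsLocalRing.ResidueField R) :=
    isSimpleModule_iff_quot_maximal.mpr
      ⟨IsLocalRing.maximalIdeal R, inferInstance, ⟨LinearEquiv.refl R _⟩⟩
  have e := LinearEquiv.ofInjective g hg
  obtain ⟨v, hv, hvM⟩ := hR.exists_eq_mul_canonicalSubmodule hF hF' hM hc0 hc
    (by rintro _ ⟨m, rfl⟩; exact ⟨_, rfl⟩) (fun w w' hw hw' hwM => by
      obtain ⟨r, hr⟩ := exists_sub_smul_mem_of_length_ext_le_one (A := R) (R := R)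
        (LinearMap.range g) (Module.length_ne_top_iff.mp (by
          rw [Module.length_eq_one]; exact ENat.one_ne_top)) ⟨x, hxm, hR.algebraMap_ne_zero hx⟩
        (((ModuleExt.congrRight (IsLocalRing.ResidueField R) e 1).length_eq.symm.trans h₁).le)
        hw hw' (fun h => hwM (by simpa using h 1))
      exact ⟨r, by simpa using hr 1⟩)
  let μ : canonicalSubmodule K R F →ₗ[R] PowerSeries K :=
    LinearMap.mulLeft R v ∘ₗ (canonicalSubmodule K R F).subtype
  have hμ : Function.Injective μ := (mul_right_injective₀ hv).comp (Submodule.subtype_injective _)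
  have hμr : LinearMap.range μ = LinearMap.range g := by
    ext f
    rw [hvM]
    constructor
    · rintro ⟨q, rfl⟩; exact ⟨q, q.2, rfl⟩
    · rintro ⟨q, hq, rfl⟩; exact ⟨⟨q, hq⟩, rfl⟩
  exact ⟨e.trans ((LinearEquiv.ofEq _ _ hμr.symm).trans (LinearEquiv.ofInjective μ hμ).symm)⟩

end IsSemigroupRing

end Canonical

/-! ## Integral birational extensions of local domains -/

section Birational

variable {A R : Type u} [CommRing A] [CommRing R] [Algebra A R] [Module.Finite A R]

theorem isLocalHom_of_finite_injective (hinj : Function.Injective (algebraMap A R)) :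
    IsLocalHom (algebraMap A R) :=
  have : FaithfulSMul A R := (faithfulSMul_iff_algebraMap_injective A R).mpr hinj
  inferInstance

/-- Lengths over `A` and over `R` differ by the factor `[k_R : k_A]`, which is finite. -/
theorem isFiniteLength_of_finite_local [IsLocalRing A] [IsLocalRing R] [IsLocalHom (algebraMap A R)]
    {M : Type*} [AddCommGroup M] [Module R M] [Module A M] [IsScalarTower A R M]
    (hM : IsFiniteLength R M) : IsFiniteLength A M := by
  rw [← Module.length_ne_top_iff] at hM ⊢
  rw [IsLocalRing.length_restrictScalars A R M, Module.length_eq_finrank]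
  exact WithTop.mul_ne_top hM (ENat.natCast_ne_top _)

theorem exists_conductor_of_finite [IsDomain R] (hinj : Function.Injective (algebraMap A R))
    (hfrac : ∀ r : R, ∃ a : A, a ≠ 0 ∧ ∃ b : A, a • r = algebraMap A R b) :
    ∃ a : A, a ≠ 0 ∧ ∀ r : R, ∃ b : A, a • r = algebraMap A R b := by
  obtain ⟨s, hs⟩ := Module.Finite.fg_top (R := A) (M := R)
  have : IsDomain A := hinj.isDomain _
  choose d hd hd' using hfrac
  refine ⟨∏ r ∈ s, d r, Finset.prod_ne_zero_iff.mpr fun r _ => hd r, fun r => ?_⟩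
  have hr : r ∈ Submodule.span A (s : Set R) := hs ▸ Submodule.mem_top
  induction hr using Submodule.span_induction with
  | mem r hr =>
    obtain ⟨b, hb⟩ := hd' r
    obtain ⟨e, he⟩ := Finset.dvd_prod_of_mem d (Finset.mem_coe.mp hr)
    exact ⟨e * b, by rw [he, mul_comm, mul_smul, hb, map_mul, Algebra.smul_def]⟩
  | zero => exact ⟨0, by simp⟩
  | add x y _ _ hx hy =>
    obtain ⟨b, hb⟩ := hx
    obtain ⟨b', hb'⟩ := hy
    exact ⟨b + b', by rw [smul_add, hb, hb', map_add]⟩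
  | smul t x _ hx =>
    obtain ⟨b, hb⟩ := hx
    exact ⟨t * b, by rw [smul_comm, hb, map_mul, Algebra.smul_def]⟩

theorem isFiniteLength_quotient_span_of_finite [IsLocalRing A] [IsLocalRing R] [IsDomain R]
    [IsLocalHom (algebraMap A R)]
    (hR : ∀ y : R, y ≠ 0 → IsFiniteLength R (R ⧸ Ideal.span {y}))
    (hinj : Function.Injective (algebraMap A R)) {a : A} (ha : a ≠ 0)
    (haR : ∀ r : R, ∃ b : A, a • r = algebraMap A R b) (y : A) (hy : y ≠ 0) :
    IsFiniteLength A (A ⧸ Ideal.span {y}) := by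
  have : IsDomain A := hinj.isDomain _
  let z := algebraMap A R (y * a)
  have hz : z ≠ 0 := by
    rw [ne_eq, ← map_zero (algebraMap A R)]
    exact fun h => mul_ne_zero hy ha (hinj h)
  have h1 : IsFiniteLength A (R ⧸ Ideal.span {z}) := isFiniteLength_of_finite_local (hR z hz)
  let φ : A →ₗ[A] R ⧸ Ideal.span {z} :=
    (Submodule.mkQ (Ideal.span {z})).restrictScalars A ∘ₗ Algebra.linearMap A R
  have h2 : IsFiniteLength A (A ⧸ LinearMap.ker φ) :=
    h1.of_injective (f := (LinearMap.ker φ).liftQ φ le_rfl)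
      (LinearMap.ker_eq_bot.mp (Submodule.ker_liftQ_eq_bot _ _ _ le_rfl))
  -- If `b = y a r` with `r ∈ R`, then `a r ∈ A` because `a` is in the conductor, so `b ∈ yA`.
  have hle : LinearMap.ker φ ≤ Ideal.span {y} := by
    intro b hb
    have hb' : algebraMap A R b ∈ Ideal.span {z} := (Submodule.Quotient.mk_eq_zero _).mp hb
    obtain ⟨r, hr⟩ := Ideal.mem_span_singleton.mp hb'
    obtain ⟨e, he⟩ := haR r
    refine Ideal.mem_span_singleton.mpr ⟨e, hinj ?_⟩
    rw [hr, map_mul, ← he, Algebra.smul_def]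
    change algebraMap A R (y * a) * r = _
    rw [map_mul, mul_assoc]
  exact h2.of_surjective (f := Submodule.factor hle) (Submodule.factor_surjective hle)

theorem length_residueField_ext_self_eq_one {A : Type u} [CommRing A] [IsDomain A] [IsLocalRing A]
    (hA : ∀ y : A, y ≠ 0 → IsFiniteLength A (A ⧸ Ideal.span {y})) (hfield : ¬ IsField A)
    (hi : HasFiniteInjectiveDimension A A) :
    Module.length A (ModuleExt A (IsLocalRing.ResidueField A) A 1) = 1 := by
  obtain ⟨x, hxm, hx⟩ := Submodule.exists_mem_ne_zero_of_ne_bot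
    (fun h => hfield (IsLocalRing.isField_iff_maximalIdeal_eq.mpr h))
  refine ModuleExt.length_residueField_eq_one A (mem_nonZeroDivisors_of_ne_zero hx) hxm (hA x hx) hi
    (ModuleExt.subsingleton_zero_of_smul_injective A hxm fun m hm =>
      (mul_eq_zero.mp hm).resolve_left hx)
    (length_quotient_lsmul_of_injective hA (f := LinearMap.id) Function.injective_id hx)

end Birational

/-- The conductor of `A` in `R`. -/
def conductorIdeal (A R : Type*) [CommRing A] [CommRing R] [Algebra A R] : Ideal R where
  carrier := {r | ∀ s : R, ∃ b : A, s * r = algebraMap A R b}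
  zero_mem' _ := ⟨0, by simp⟩
  add_mem' {x y} hx hy s := by
    obtain ⟨b, hb⟩ := hx s
    obtain ⟨b', hb'⟩ := hy s
    exact ⟨b + b', by rw [mul_add, hb, hb', map_add]⟩
  smul_mem' t x hx s := by
    rw [smul_eq_mul, ← mul_assoc]
    exact hx _

/-- Filter `R/𝔠` by `A/𝔠` and `R/A`. Since `A/𝔠 = (A : A)/(A : R)`, it embeds in `Ext¹(R/A, A)`, and
type at most one bounds its length by `ℓ(R/A)`. -/
theorem length_quotient_conductorIdeal_le {A R : Type u} [CommRing A] [IsLocalRing A] [CommRing R]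
    [IsDomain R] [Algebra A R]
    (hfrac : ∀ r : R, ∃ a : A, algebraMap A R a ≠ 0 ∧ ∃ b : A, a • r = algebraMap A R b)
    (hinj : Function.Injective (algebraMap A R))
    (h₁ : Module.length A (ModuleExt A (IsLocalRing.ResidueField A) A 1) ≤ 1) :
    Module.length A (R ⧸ conductorIdeal A R) ≤
      2 * Module.length A (R ⧸ LinearMap.range (Algebra.linearMap A R)) := by
  by_cases hfin : IsFiniteLength A (R ⧸ LinearMap.range (Algebra.linearMap A R))
  swap
  · rw [← Module.length_ne_top_iff, not_not] at hfin
    rw [hfin]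
    exact le_of_le_of_eq le_top (ENat.mul_top two_ne_zero).symm
  let Q : Submodule A R := LinearMap.range (Algebra.linearMap A R)
  let e : A ≃ₗ[A] Q := LinearEquiv.ofInjective (Algebra.linearMap A R) hinj
  let c : Submodule A R := (conductorIdeal A R).restrictScalars A
  have hcQ : c ≤ Q := fun r hr => by
    obtain ⟨b, hb⟩ := hr 1
    exact ⟨b, by rw [← one_mul r, hb]; rfl⟩
  have hQQ : Q / Q = Q := by
    ext q
    rw [Submodule.mem_div_iff_forall_mul_mem]
    constructor
    · intro h
      simpa using h 1 ⟨1, by simp⟩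
    · rintro ⟨b, rfl⟩ _ ⟨b', rfl⟩
      exact ⟨b * b', by simp⟩
  have hQt : Q / ⊤ = c := by
    ext q
    rw [Submodule.mem_div_iff_forall_mul_mem]
    constructor
    · intro h s
      obtain ⟨b, hb⟩ := h s trivial
      exact ⟨b, by rw [mul_comm, ← hb]; rfl⟩
    · rintro h s -
      obtain ⟨b, hb⟩ := h s
      exact ⟨b, by rw [mul_comm, hb]; rfl⟩
  have et : (↥(⊤ : Submodule A R) ⧸ Q.submoduleOf ⊤) ≃ₗ[A] R ⧸ Q :=
    Submodule.Quotient.equiv _ _ Submodule.topEquiv (by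
      ext q
      simp [Submodule.submoduleOf])
  have h2 : Module.length A (Q ⧸ c.submoduleOf Q) ≤ Module.length A (R ⧸ Q) := by
    have h3 := length_div_quotient_le (I := Q) (J := ⊤) Q (fun r _ => by
      obtain ⟨a, ha, b, hb⟩ := hfrac r
      exact ⟨a, ha, b, hb.symm⟩)
    rw [hQQ, hQt] at h3
    have hfin' : IsFiniteLength A (↥(⊤ : Submodule A R) ⧸ Q.submoduleOf ⊤) := by
      rw [← Module.length_ne_top_iff] at hfin ⊢
      rwa [et.length_eq]
    refine h3.trans ((ModuleExt.length_le Q hfin' 1).trans ?_)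
    rw [et.length_eq, ← (ModuleExt.congrRight _ e 1).length_eq]
    exact (mul_le_mul' le_rfl h₁).trans (mul_one _).le
  have hex : Function.Exact (Submodule.mapQ (c.submoduleOf Q) c Q.subtype le_rfl)
      (Submodule.factor hcQ) := by
    rw [LinearMap.exact_iff]
    ext x
    obtain ⟨x, rfl⟩ := Submodule.mkQ_surjective _ x
    have hx : Submodule.factor hcQ (c.mkQ x) = Submodule.Quotient.mk x := rfl
    rw [LinearMap.mem_ker, hx, Submodule.Quotient.mk_eq_zero]
    constructor
    · intro hx
      exact ⟨Submodule.Quotient.mk ⟨x, hx⟩, rfl⟩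
    · rintro ⟨y, hy⟩
      obtain ⟨y, rfl⟩ := Submodule.mkQ_surjective _ y
      have : (y : R) - x ∈ c := (Submodule.Quotient.eq _).mp hy
      have := sub_mem y.2 (hcQ this)
      rwa [sub_sub_cancel] at this
  refine (Module.length_le_add_of_exact hex).trans ?_
  rw [two_mul]
  exact add_le_add h2 le_rfl

/-! ## Gorenstein subrings and the trace of the canonical module -/

section TraceBound

open PowerSeries

variable {K : Type u} [Field K] {H : AddSubmonoid ℕ} {R : Type u} [CommRing R] [Algebra K R]
  [Algebra R (PowerSeries K)]

namespace IsSemigroupRing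

/-- The conductor of a Gorenstein birational subring is isomorphic to the canonical module. -/
theorem conductorIdeal_le_moduleTrace (hR : IsSemigroupRing K H R) [IsLocalRing R] {F : ℕ}
    (hF : F ∉ H) (hF' : ∀ n, F < n → n ∈ H) {A : Type u} [CommRing A] [IsLocalRing A]
    [IsNoetherianRing A] [Algebra A R] [IsLocalHom (algebraMap A R)]
    (hinj : Function.Injective (algebraMap A R))
    (hk : IsFiniteLength A (IsLocalRing.ResidueField R)) (hfield : ¬ IsField A)
    (h₁ : Module.length A (ModuleExt A (IsLocalRing.ResidueField A) A 1) ≤ 1)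
    (hc : conductorIdeal A R ≠ ⊥) :
    conductorIdeal A R ≤ moduleTrace R (canonicalSubmodule K R F) := by
  let : Algebra A (PowerSeries K) :=
    ((algebraMap R (PowerSeries K)).comp (algebraMap A R)).toAlgebra
  have : IsScalarTower A R (PowerSeries K) := IsScalarTower.of_algebraMap_eq' rfl
  have hinj' : Function.Injective (algebraMap A (PowerSeries K)) := hR.injective.comp hinj
  obtain ⟨c, hc0, hcH⟩ := hR.numerical.exists_conductor
  have hX : (X ^ c : PowerSeries K) ≠ 0 := pow_ne_zero c X_ne_zero
  let g : A →ₗ[A] PowerSeries K :=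
    LinearMap.mulLeft A (X ^ c : PowerSeries K) ∘ₗ Algebra.linearMap A (PowerSeries K)
  have hg : Function.Injective g := (mul_right_injective₀ hX).comp hinj'
  let N : Submodule A (PowerSeries K) := LinearMap.range g
  have e : A ≃ₗ[A] N := LinearEquiv.ofInjective g hg
  -- With `N = t^c A`, this is `N : R = t^c 𝔠`; the shift by `t^c` serves the divisibility
  -- hypothesis of `exists_eq_mul_canonicalSubmodule`.
  let M : Submodule R (PowerSeries K) :=
    { carrier := {f | ∀ r : R, r • f ∈ N}
      zero_mem' r := by rw [smul_zero]; exact N.zero_mem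
      add_mem' hx hy r := by rw [smul_add]; exact N.add_mem (hx r) (hy r)
      smul_mem' t x hx r := by rw [smul_smul]; exact hx _ }
  have hMN : ∀ f ∈ M, f ∈ N := fun f hf => by simpa using hf 1
  have hMc : ∀ r : R, X ^ c * algebraMap R (PowerSeries K) r ∈ M ↔ r ∈ conductorIdeal A R := by
    intro r
    refine forall_congr' fun s => ⟨?_, ?_⟩
    · rintro ⟨b, hb⟩
      refine ⟨b, hR.injective (mul_left_cancel₀ hX ?_)⟩
      rw [map_mul, ← mul_assoc, mul_comm _ (algebraMap R _ s), mul_assoc, ← Algebra.smul_def, ← hb]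
      rfl
    · rintro ⟨b, hb⟩
      refine ⟨b, ?_⟩
      rw [Algebra.smul_def, mul_left_comm, ← map_mul, hb]
      rfl
  have hM : M ≠ ⊥ := by
    obtain ⟨r, hr, hr0⟩ := Submodule.exists_mem_ne_zero_of_ne_bot hc
    intro h
    have h2 := (hMc r).mpr hr
    rw [h, Submodule.mem_bot] at h2
    exact mul_ne_zero hX (hR.algebraMap_ne_zero hr0) h2
  obtain ⟨x, hxm, hx⟩ := Submodule.exists_mem_ne_zero_of_ne_bot
    (fun h => hfield (IsLocalRing.isField_iff_maximalIdeal_eq.mpr h))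
  obtain ⟨v, hv, hvM⟩ := hR.exists_eq_mul_canonicalSubmodule hF hF' hM hc0 hcH
    (fun f hf => by obtain ⟨b, hb⟩ := hMN f hf; exact ⟨_, hb.symm⟩)
    (fun w w' hw hw' hwM => by
      refine exists_sub_smul_mem_of_length_ext_le_one (A := A) (R := R) N hk ⟨x, ?_, ?_⟩
        ((ModuleExt.congrRight (IsLocalRing.ResidueField A) e 1).length_eq.symm.le.trans h₁)
        (fun a ha => hMN _ (hw a ha)) (fun a ha => hMN _ (hw' a ha)) hwM
      · exact map_nonunit (algebraMap A R) x hxm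
      · exact fun h => hx (hinj' (by rw [h, map_zero])))
  -- Now `vω = t^c 𝔠`, so `q ↦ vq / t^c` is a map `ω → R` with image `𝔠`.
  have hdvd : ∀ q : canonicalSubmodule K R F, ∃ r : R,
      X ^ c * algebraMap R (PowerSeries K) r = v * (q : PowerSeries K) := by
    intro q
    obtain ⟨b, hb⟩ := hMN _ ((hvM _).mpr ⟨q, q.2, rfl⟩)
    exact ⟨algebraMap A R b, hb⟩
  choose φ hφ using hdvd
  have hinjc : ∀ {r s : R}, X ^ c * algebraMap R (PowerSeries K) r =
      X ^ c * algebraMap R (PowerSeries K) s → r = s :=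
    fun h => hR.injective (mul_left_cancel₀ hX h)
  let ψ : canonicalSubmodule K R F →ₗ[R] R :=
    { toFun := φ
      map_add' p q := hinjc (by
        rw [hφ, map_add, mul_add, hφ, hφ, ← mul_add]; rfl)
      map_smul' r q := hinjc (by
        rw [hφ, RingHom.id_apply, smul_eq_mul, map_mul, mul_left_comm, hφ, Submodule.coe_smul,
          Algebra.smul_def, mul_left_comm]) }
  refine le_trans ?_ (le_iSup _ ψ)
  intro r hr
  obtain ⟨q, hq, hrq⟩ := (hvM _).mp ((hMc r).mpr hr)
  exact ⟨⟨q, hq⟩, hinjc ((hφ _).trans hrq.symm)⟩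

/-- From `𝔠 ⊆ tr ω`, passing from `R`-length to `A`-length can only increase the number, and duality
over `A` gives the factor two. -/
theorem length_quotient_moduleTrace_le (hR : IsSemigroupRing K H R) [IsLocalRing R] {F : ℕ}
    (hF : F ∉ H) (hF' : ∀ n, F < n → n ∈ H) {A : Type u} [CommRing A] [Algebra A R]
    [Module.Finite A R] (hinj : Function.Injective (algebraMap A R))
    (hfrac : ∀ r : R, ∃ a : A, a ≠ 0 ∧ ∃ b : A, a • r = algebraMap A R b)
    (hA : IsGorensteinRing A) :
    Module.length R (R ⧸ moduleTrace R (canonicalSubmodule K R F)) ≤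
      2 * Module.length A (R ⧸ LinearMap.range (Algebra.linearMap A R)) := by
  have := hR.isDomain
  have : IsDomain A := hinj.isDomain _
  have := isLocalHom_of_finite_injective hinj
  have : IsLocalRing A := (algebraMap A R).domain_isLocalRing
  obtain ⟨hN, hi⟩ := isGorensteinRing_iff_of_isLocalRing.mp hA
  have hfield : ¬ IsField A := fun h =>
    hR.not_isField ((Algebra.IsIntegral.isField_iff_isField hinj).mp h)
  obtain ⟨a, ha, haR⟩ := exists_conductor_of_finite hinj hfrac
  have h₁ := length_residueField_ext_self_eq_one
    (isFiniteLength_quotient_span_of_finite hR.isFiniteLength_quotient_span hinj ha haR) hfield hi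
  have hsimple : IsSimpleModule R (IsLocalRing.ResidueField R) :=
    isSimpleModule_iff_quot_maximal.mpr
      ⟨IsLocalRing.maximalIdeal R, inferInstance, ⟨LinearEquiv.refl R _⟩⟩
  have hk : IsFiniteLength A (IsLocalRing.ResidueField R) :=
    isFiniteLength_of_finite_local (Module.length_ne_top_iff.mp (by
      rw [Module.length_eq_one]; exact ENat.one_ne_top) : IsFiniteLength R _)
  have hc : conductorIdeal A R ≠ ⊥ := by
    intro h
    have : algebraMap A R a ∈ conductorIdeal A R := fun s => by
      obtain ⟨b, hb⟩ := haR s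
      exact ⟨b, by rw [← hb, Algebra.smul_def, mul_comm]⟩
    rw [h, Submodule.mem_bot] at this
    exact ha (hinj (by rw [this, map_zero]))
  have hle := hR.conductorIdeal_le_moduleTrace hF hF' hinj hk hfield h₁.le hc
  calc Module.length R (R ⧸ moduleTrace R (canonicalSubmodule K R F))
      ≤ Module.length R (R ⧸ conductorIdeal A R) :=
        Module.length_le_of_surjective _ (Submodule.factor_surjective hle)
    _ ≤ Module.length A (R ⧸ conductorIdeal A R) := by
        rw [IsLocalRing.length_restrictScalars A R]
        refine le_mul_of_one_le_right bot_le ?_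
        rw [Order.one_le_iff_pos]
        exact Module.length_pos
    _ ≤ _ := length_quotient_conductorIdeal_le (fun r => by
        obtain ⟨a, ha, hb⟩ := hfrac r
        exact ⟨a, fun h => ha (hinj (by rw [h, map_zero])), hb⟩) hinj h₁.le

end IsSemigroupRing

end TraceBound

/-! ## Monomial data of `K[[H]]` -/

section Monomial

open PowerSeries

variable {K : Type u} [Field K] {H : AddSubmonoid ℕ} {R : Type u} [CommRing R] [Algebra K R]
  [Algebra R (PowerSeries K)]

namespace IsSemigroupRing

/-- The residue field of `R` is `K`, so lengths are `K`-dimensions. -/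
theorem length_eq_length_base (hR : IsSemigroupRing K H R) [IsLocalRing R] {N : Type u}
    [AddCommGroup N] [Module K N] [Module R N] [IsScalarTower K R N] :
    Module.length R N = Module.length K N := by
  have := hR.tower
  have hsimple : IsSimpleModule R (IsLocalRing.ResidueField R) :=
    isSimpleModule_iff_quot_maximal.mpr
      ⟨IsLocalRing.maximalIdeal R, inferInstance, ⟨LinearEquiv.refl R _⟩⟩
  have hsurj : Function.Surjective (algebraMap K (IsLocalRing.ResidueField R)) := by
    intro y
    obtain ⟨r, rfl⟩ := IsLocalRing.residue_surjective y
    refine ⟨constantCoeff (algebraMap R (PowerSeries K) r), ?_⟩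
    change IsLocalRing.residue R (algebraMap K R _) = _
    rw [← sub_eq_zero, ← map_sub, IsLocalRing.residue_eq_zero_iff, hR.mem_maximalIdeal_iff,
      map_sub, ← IsScalarTower.algebraMap_apply, map_sub, PowerSeries.algebraMap_apply, sub_eq_zero]
    simp
  have hk : Module.length K (IsLocalRing.ResidueField R) = 1 := by
    rw [Module.length_eq_of_surjective (M := IsLocalRing.ResidueField R) hsurj]
    exact Module.length_eq_one _ _
  have h1 := IsLocalRing.length_restrictScalars K R (IsLocalRing.ResidueField R)
  rw [hk, Module.length_eq_one, one_mul] at h1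
  rw [IsLocalRing.length_restrictScalars K R N, ← h1, mul_one]

/-- The colength of a submodule given by the vanishing of finitely many coefficients. -/
theorem length_quotient_eq_card {H' : AddSubmonoid ℕ} {S : Type u} [CommRing S] [Algebra K S]
    [Algebra S (PowerSeries K)] (hS : IsSemigroupRing K H' S) [IsLocalRing S]
    (hR : IsSemigroupRing K H R) [Algebra S R] [IsScalarTower K S R] {D : Finset ℕ}
    (hD : ∀ n ∈ D, n ∈ H) {T : Submodule S R}
    (hT : ∀ r, r ∈ T ↔ ∀ n ∈ D, coeff n (algebraMap R (PowerSeries K) r) = 0) :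
    Module.length S (R ⧸ T) = D.card := by
  have := hR.tower
  let ψ : R →ₗ[K] (D → K) := LinearMap.pi fun n =>
    (coeff (n : ℕ)) ∘ₗ (IsScalarTower.toAlgHom K R (PowerSeries K)).toLinearMap
  have hψ : ∀ r n, ψ r n = coeff (n : ℕ) (algebraMap R (PowerSeries K) r) := fun r n => rfl
  have hker : T.restrictScalars K = LinearMap.ker ψ := by
    ext r
    rw [Submodule.restrictScalars_mem, hT, LinearMap.mem_ker, funext_iff]
    simp [hψ]
  have hsurj : Function.Surjective ψ := by
    intro a
    obtain ⟨r, hr⟩ := (hR.mem_range_iff (PowerSeries.mk fun n =>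
      if h : n ∈ D then a ⟨n, h⟩ else 0)).mpr fun n hn => by
        rw [coeff_mk, dif_neg fun h => hn (hD n h)]
    refine ⟨r, funext fun n => ?_⟩
    rw [hψ, hr, coeff_mk, dif_pos n.2]
  rw [hS.length_eq_length_base, ← (Submodule.Quotient.restrictScalarsEquiv K T).length_eq, hker,
    (ψ.quotKerEquivOfSurjective hsurj).length_eq, Module.length_eq_finrank,
    Module.finrank_fintype_fun_eq_card, Fintype.card_coe]

/-- The ring of a symmetric numerical semigroup is Gorenstein. -/
theorem isGorensteinRing (hR : IsSemigroupRing K H R) {F : ℕ} (hF : ∀ n, F < n → n ∈ H)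
    (hsymm : ∀ i j, i + j = F → (i ∈ H ↔ j ∉ H)) : IsGorensteinRing R := by
  have := hR.isLocalRing
  refine isGorensteinRing_iff_of_isLocalRing.mpr ⟨hR.isNoetherianRing, ?_⟩
  -- Symmetry says that `i ∈ H` exactly when `F - i ∉ H`, so `R` is its own canonical fractional
  -- ideal.
  have hrange : LinearMap.range (Algebra.linearMap R (PowerSeries K)) =
      canonicalSubmodule K R F := by
    ext f
    rw [hR.mem_canonicalSubmodule_iff, LinearMap.mem_range]
    refine (hR.mem_range_iff f).trans ⟨fun h i j hij hj => ?_, fun h n hn => ?_⟩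
    · exact h i fun hi => (hsymm i j hij).mp hi hj
    · by_cases hnF : n ≤ F
      · exact h n (F - n) (by omega) (by_contra fun h' => hn ((hsymm n _ (by omega)).mpr h'))
      · exact absurd (hF n (by omega)) hn
  exact (hR.hasInjectiveDimensionLE_canonicalSubmodule hF).of_linearEquiv
    ((LinearEquiv.ofInjective (Algebra.linearMap R (PowerSeries K)) hR.injective).trans
      (LinearEquiv.ofEq _ _ hrange)).symm

/-- The condition `∀ j ∈ H, i + j ≠ F` expresses `F - i ∉ H` without subtraction: these are the
exponents of `ω`. So `hp` says that `p` multiplies `ω` into `R`. -/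
theorem exists_algebraMap_eq_mul (hR : IsSemigroupRing K H R) {F : ℕ} {p f : PowerSeries K}
    (hp : ∀ n i, coeff n p ≠ 0 → (∀ j ∈ H, i + j ≠ F) → n + i ∈ H)
    (hf : f ∈ canonicalSubmodule K R F) :
    ∃ r : R, algebraMap R (PowerSeries K) r = p * f := by
  rw [hR.mem_range_iff]
  rw [hR.mem_canonicalSubmodule_iff] at hf
  intro n hn
  rw [coeff_mul]
  refine Finset.sum_eq_zero fun ab hab => ?_
  rw [Finset.HasAntidiagonal.mem_antidiagonal] at hab
  by_contra h
  exact hn (hab ▸ hp _ _ (left_ne_zero_of_mul h) fun j hj hij =>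
    right_ne_zero_of_mul h (hf _ _ hij hj))

theorem mem_moduleTrace_of_eq_mul (hR : IsSemigroupRing K H R) {F : ℕ} {p f : PowerSeries K}
    (hp : ∀ n i, coeff n p ≠ 0 → (∀ j ∈ H, i + j ≠ F) → n + i ∈ H)
    (hf : f ∈ canonicalSubmodule K R F) {r : R} (hr : algebraMap R (PowerSeries K) r = p * f) :
    r ∈ moduleTrace R (canonicalSubmodule K R F) := by
  choose φ hφ using fun f : canonicalSubmodule K R F => hR.exists_algebraMap_eq_mul hp f.2
  let ψ : canonicalSubmodule K R F →ₗ[R] R :=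
    { toFun := φ
      map_add' p q := hR.injective (by
        rw [hφ, map_add, hφ, hφ, ← mul_add]; rfl)
      map_smul' r q := hR.injective (by
        rw [hφ, RingHom.id_apply, smul_eq_mul, map_mul, hφ, Submodule.coe_smul,
          Algebra.smul_def, mul_left_comm]) }
  exact le_iSup (fun f : canonicalSubmodule K R F →ₗ[R] R => LinearMap.range f) ψ
    ⟨⟨f, hf⟩, hR.injective ((hφ _).trans hr.symm)⟩

theorem X_pow_mem_canonicalSubmodule (hR : IsSemigroupRing K H R) {F i : ℕ}
    (hi : ∀ j ∈ H, i + j ≠ F) : X ^ i ∈ canonicalSubmodule K R F := by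
  rw [hR.mem_canonicalSubmodule_iff]
  rintro n j hnj hj
  rw [coeff_X_pow, if_neg]
  rintro rfl
  exact hi j hj hnj

/-- Take `p = φ(1)`, where `1 ∈ ω` because `F ∉ H`. For any `f`, linearity applied to `(t^c f) · 1 =
t^c · f`, with `t^c f` and `t^c` in `R`, gives `φ(f) = p f`. -/
theorem exists_eq_mul_of_linearMap (hR : IsSemigroupRing K H R) {F : ℕ} (hF : F ∉ H)
    (φ : canonicalSubmodule K R F →ₗ[R] R) :
    ∃ p : PowerSeries K, (∀ n i, coeff n p ≠ 0 → (∀ j ∈ H, i + j ≠ F) → n + i ∈ H) ∧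
      ∀ f, algebraMap R (PowerSeries K) (φ f) = p * f := by
  have h1 : (1 : PowerSeries K) ∈ canonicalSubmodule K R F := by
    rw [← pow_zero X]
    refine hR.X_pow_mem_canonicalSubmodule fun j hj hj' => hF ?_
    rwa [← hj', zero_add]
  have hmul : ∀ f : canonicalSubmodule K R F, algebraMap R (PowerSeries K) (φ f) =
      algebraMap R (PowerSeries K) (φ ⟨1, h1⟩) * f := by
    intro f
    obtain ⟨c, -, hc⟩ := hR.numerical.exists_conductor
    obtain ⟨r, hr⟩ := hR.exists_eq_X_pow_mul hc (f : PowerSeries K)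
    obtain ⟨s, hs⟩ := hR.exists_algebraMap_eq_X_pow (hc c le_rfl)
    have h2 : r • (⟨1, h1⟩ : canonicalSubmodule K R F) = s • f := by
      refine Subtype.ext ?_
      rw [Submodule.coe_smul, Submodule.coe_smul, Algebra.smul_def, Algebra.smul_def, hr, hs,
        mul_one]
    have h3 := congrArg (algebraMap R (PowerSeries K)) (congrArg φ h2)
    rw [φ.map_smul, φ.map_smul, smul_eq_mul, smul_eq_mul, map_mul, map_mul, hr, hs, mul_assoc] at h3
    rw [← mul_left_cancel₀ (pow_ne_zero c X_ne_zero) h3, mul_comm]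
  refine ⟨_, fun n i hn hi => ?_, hmul⟩
  by_contra hni
  refine hn ?_
  have h4 := hmul ⟨_, hR.X_pow_mem_canonicalSubmodule hi⟩
  rw [← coeff_mul_X_pow _ i, ← h4]
  exact hR.coeff_eq_zero _ hni

end IsSemigroupRing

end Monomial

/-! ## The family of numerical semigroups -/

/-- Sums of two generators fill `[12ℓ+20, 18ℓ+28]` and sums of three fill `[18ℓ+30, 27ℓ+42]`; beyond
that, subtracting `6ℓ+10` stays in range. -/
theorem mem_semigroupH'_iff {l n : ℕ} : n ∈ semigroupH' l ↔
    n = 0 ∨ (6 * l + 10 ≤ n ∧ n ≤ 9 * l + 14) ∨ (12 * l + 20 ≤ n ∧ n ≤ 18 * l + 28) ∨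
      18 * l + 30 ≤ n := by
  have hgen : ∀ m, 6 * l + 10 ≤ m → m ≤ 9 * l + 14 → m ∈ semigroupH' l :=
    fun m h1 h2 => AddSubmonoid.subset_closure ⟨h1, h2⟩
  have hadd : ∀ {a b : ℕ}, a ∈ semigroupH' l → b ∈ semigroupH' l → ∀ m, m = a + b →
      m ∈ semigroupH' l := by
    rintro a b ha hb m rfl
    exact add_mem ha hb
  have h2 : ∀ m, 12 * l + 20 ≤ m → m ≤ 18 * l + 28 → m ∈ semigroupH' l := fun m h h' =>
    hadd (hgen (m / 2) (by omega) (by omega)) (hgen (m - m / 2) (by omega) (by omega)) m (by omega)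
  constructor
  · intro hn
    induction hn using AddSubmonoid.closure_induction with
    | mem x hx => exact Or.inr (Or.inl hx)
    | zero => exact Or.inl rfl
    | add x y _ _ hx hy => omega
  · rintro (rfl | ⟨h, h'⟩ | ⟨h, h'⟩ | h)
    · exact zero_mem _
    · exact hgen n h h'
    · exact h2 n h h'
    · induction n using Nat.strong_induction_on with
      | _ n ih =>
        rcases le_or_gt n (27 * l + 42) with hn | hn
        · exact hadd (hgen (n / 3) (by omega) (by omega))
            (h2 (n - n / 3) (by omega) (by omega)) n (by omega)
        · exact hadd (hgen (6 * l + 10) le_rfl (by omega))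
            (ih (n - (6 * l + 10)) (by omega) (by omega)) n (by omega)

theorem semigroupH'_le (l : ℕ) : semigroupH' l ≤ semigroupH l :=
  AddSubmonoid.closure_mono fun _ h => Or.inl h

/-- From `12ℓ+20` on, `H'` misses only `18ℓ+29 = (9ℓ+12) + (9ℓ+17)`, so below that bound only the
extra generators up to `12ℓ+17` matter. -/
theorem mem_semigroupH_iff {l n : ℕ} : n ∈ semigroupH l ↔
    n = 0 ∨ (6 * l + 10 ≤ n ∧ n ≤ 9 * l + 14) ∨
      (9 * l + 17 ≤ n ∧ n ≤ 12 * l + 17 ∧ n % 3 = 2) ∨ 12 * l + 20 ≤ n := by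
  constructor
  · intro hn
    induction hn using AddSubmonoid.closure_induction with
    | mem x hx =>
      rcases hx with hx | ⟨s, hs, rfl⟩
      · exact Or.inr (Or.inl hx)
      · omega
    | zero => exact Or.inl rfl
    | add x y _ _ hx hy =>
      have hx0 : x = 0 ∨ 6 * l + 10 ≤ x := by omega
      have hy0 : y = 0 ∨ 6 * l + 10 ≤ y := by omega
      rcases hx0 with rfl | hx0
      · rwa [zero_add]
      rcases hy0 with rfl | hy0
      · rwa [add_zero]
      omega
  · rintro (rfl | ⟨h, h'⟩ | ⟨h, h', h3⟩ | h)
    · exact zero_mem _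
    · exact semigroupH'_le l (mem_semigroupH'_iff.mpr (Or.inr (Or.inl ⟨h, h'⟩)))
    · exact AddSubmonoid.subset_closure (Or.inr ⟨(n - (9 * l + 17)) / 3, by omega, by omega⟩)
    · by_cases hn : n = 18 * l + 29
      · have h1 : 9 * l + 12 ∈ semigroupH l := AddSubmonoid.subset_closure
          (Or.inl ⟨by omega, by omega⟩)
        have h2 : 9 * l + 17 ∈ semigroupH l := AddSubmonoid.subset_closure
          (Or.inr ⟨0, by omega, by omega⟩)
        rw [hn, show 18 * l + 29 = 9 * l + 12 + (9 * l + 17) by omega]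
        exact add_mem h1 h2
      · exact semigroupH'_le l (mem_semigroupH'_iff.mpr (by omega))

theorem mem_semigroupH_of_lt {l n : ℕ} (h : 12 * l + 19 < n) : n ∈ semigroupH l :=
  mem_semigroupH_iff.mpr (by omega)

theorem notMem_semigroupH (l : ℕ) : 12 * l + 19 ∉ semigroupH l := by
  rw [mem_semigroupH_iff]
  omega

theorem isNumericalSemigroup_of_forall_lt {H : AddSubmonoid ℕ} {F : ℕ}
    (h : ∀ n, F < n → n ∈ H) : IsNumericalSemigroup H :=
  (Set.finite_Iic F).subset fun n hn => not_lt.mp fun h' => hn (h n h')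

theorem mem_semigroupH'_of_lt {l n : ℕ} (h : 18 * l + 29 < n) : n ∈ semigroupH' l :=
  mem_semigroupH'_iff.mpr (by omega)

theorem mem_semigroupH'_iff_of_add_eq {l i j : ℕ} (h : i + j = 18 * l + 29) :
    i ∈ semigroupH' l ↔ j ∉ semigroupH' l := by
  rw [mem_semigroupH'_iff, mem_semigroupH'_iff]
  omega

theorem isSymmetricSemigroup_of_forall {H : AddSubmonoid ℕ} {F : ℕ} (hF : ∀ n, F < n → n ∈ H)
    (hsymm : ∀ i j, i + j = F → (i ∈ H ↔ j ∉ H)) : IsSymmetricSemigroup H := by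
  have hF' : F ∉ H := (hsymm 0 F (zero_add F)).mp (zero_mem H)
  have hcast : ∀ n : ℕ, (∃ h ∈ H, (h : ℤ) = n) ↔ n ∈ H := fun n =>
    ⟨fun ⟨h, hh, hn⟩ => by rwa [← Nat.cast_injective hn], fun h => ⟨n, h, rfl⟩⟩
  have hneg : ∀ x : ℤ, x < 0 → ¬ ∃ h ∈ H, (h : ℤ) = x := by
    rintro x hx ⟨h, -, rfl⟩
    omega
  refine ⟨isNumericalSemigroup_of_forall_lt hF, F, ⟨(hcast F).not.mpr hF', fun x hx => ?_⟩,
    fun x => ?_⟩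
  · by_contra hxF
    lift x to ℕ using by omega
    exact (hcast x).not.mp hx (hF x (by omega))
  · rcases lt_or_ge x 0 with hx | hx
    · refine iff_of_false (hneg x hx) (not_not.mpr ?_)
      exact ⟨((F : ℤ) - x).toNat, hF _ (by omega), by omega⟩
    · lift x to ℕ using hx
      rcases lt_or_ge F x with hx | hx
      · exact iff_of_true ((hcast x).mpr (hF x hx)) (hneg _ (by omega))
      · rw [← Nat.cast_sub hx, hcast, hcast]
        exact hsymm _ _ (by omega)

/-- The exponents of the canonical fractional ideal. -/
theorem forall_add_ne_iff {l i : ℕ} : (∀ j ∈ semigroupH l, i + j ≠ 12 * l + 19) ↔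
    (i ≤ 3 * l + 4 ∧ i % 3 ≠ 2) ∨ (6 * l + 10 ≤ i ∧ i ≠ 12 * l + 19) := by
  constructor
  · intro h
    have h0 := h 0 (zero_mem _)
    by_contra hi
    refine h (12 * l + 19 - i) (mem_semigroupH_iff.mpr ?_) (by omega)
    omega
  · rintro h j hj hij
    rw [mem_semigroupH_iff] at hj
    omega

/-- The exponents of the inverse of the canonical fractional ideal. -/
theorem eq_or_le_of_forall_add_mem {l n : ℕ}
    (h : ∀ i, (∀ j ∈ semigroupH l, i + j ≠ 12 * l + 19) → n + i ∈ semigroupH l) :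
    n = 6 * l + 10 ∨ 12 * l + 20 ≤ n := by
  replace h : ∀ i, (i ≤ 3 * l + 4 ∧ i % 3 ≠ 2) ∨ (6 * l + 10 ≤ i ∧ i ≠ 12 * l + 19) → _ :=
    fun i hi => mem_semigroupH_iff.mp (h i (forall_add_ne_iff.mpr hi))
  -- Shifts by `0` and `1` leave only `6ℓ+10 ≤ n ≤ 9ℓ+13` below `12ℓ+20`. The other two shifts aim
  -- at the gaps `9ℓ+15` and `9ℓ+16`; for `n > 6ℓ+10` at least one of them is an exponent of `ω`.
  have h0 := h 0 (by omega)
  have h1 := h 1 (by omega)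
  have h2 := h (9 * l + 15 - n)
  have h3 := h (9 * l + 16 - n)
  omega

theorem add_mem_semigroupH_of_forall {l i : ℕ}
    (h : ∀ j ∈ semigroupH l, i + j ≠ 12 * l + 19) : 6 * l + 10 + i ∈ semigroupH l := by
  rw [forall_add_ne_iff] at h
  rw [mem_semigroupH_iff]
  omega

/-- The exponents of the ring outside the trace ideal of its canonical module. -/
def traceGaps (l : ℕ) : Finset ℕ :=
  insert 0 ((Finset.range (l + 1)).image (fun s => 6 * l + 12 + 3 * s) ∪
    (Finset.range (l + 1)).image (fun s => 9 * l + 17 + 3 * s))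

theorem mem_traceGaps {l n : ℕ} : n ∈ traceGaps l ↔
    n = 0 ∨ (6 * l + 12 ≤ n ∧ n ≤ 9 * l + 12 ∧ n % 3 = 0) ∨
      (9 * l + 17 ≤ n ∧ n ≤ 12 * l + 17 ∧ n % 3 = 2) := by
  simp only [traceGaps, Finset.mem_insert, Finset.mem_union, Finset.mem_image, Finset.mem_range]
  refine or_congr_right (or_congr ⟨?_, fun h => ?_⟩ ⟨?_, fun h => ?_⟩)
  · rintro ⟨s, hs, rfl⟩; omega
  · exact ⟨(n - (6 * l + 12)) / 3, by omega, by omega⟩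
  · rintro ⟨s, hs, rfl⟩; omega
  · exact ⟨(n - (9 * l + 17)) / 3, by omega, by omega⟩

theorem card_traceGaps (l : ℕ) : (traceGaps l).card = 2 * l + 3 := by
  rw [traceGaps, Finset.card_insert_of_notMem, Finset.card_union_of_disjoint,
    Finset.card_image_of_injective, Finset.card_image_of_injective, Finset.card_range]
  · omega
  · intro a b h; simpa using h
  · intro a b h; simpa using h
  · rw [Finset.disjoint_left]
    simp only [Finset.mem_image, Finset.mem_range, not_exists, not_and]
    rintro _ ⟨s, hs, rfl⟩ t ht
    omega
  · simp

theorem mem_semigroupH_of_mem_traceGaps {l n : ℕ} (h : n ∈ traceGaps l) : n ∈ semigroupH l := by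
  rw [mem_traceGaps] at h
  rw [mem_semigroupH_iff]
  omega

/-- The exponents of `K[[H]]` outside `K[[H']]`. -/
def subringGaps (l : ℕ) : Finset ℕ :=
  insert (18 * l + 29) ((Finset.range (l + 1)).image (fun s => 9 * l + 17 + 3 * s))

theorem card_subringGaps (l : ℕ) : (subringGaps l).card = l + 2 := by
  rw [subringGaps, Finset.card_insert_of_notMem, Finset.card_image_of_injective, Finset.card_range]
  · intro a b h; simpa using h
  · simp only [Finset.mem_image, Finset.mem_range, not_exists, not_and]
    intro s hs
    omega

theorem mem_subringGaps_iff {l n : ℕ} :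
    n ∈ subringGaps l ↔ n ∈ semigroupH l ∧ n ∉ semigroupH' l := by
  rw [mem_semigroupH_iff, mem_semigroupH'_iff]
  simp only [subringGaps, Finset.mem_insert, Finset.mem_image, Finset.mem_range]
  constructor
  · rintro (rfl | ⟨s, hs, rfl⟩) <;> omega
  · intro h
    by_cases hn : n = 18 * l + 29
    · exact Or.inl hn
    · exact Or.inr ⟨(n - (9 * l + 17)) / 3, by omega, by omega⟩

/-! ## Birational subrings -/

section FractionRing

variable {R : Type u} [CommRing R] [IsDomain R] {S : Subring R}

theorem isBirationalSubring_of_forall [Module.Finite S R]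
    (hfrac : ∀ r : R, ∃ a ∈ S, a ≠ 0 ∧ a * r ∈ S) : IsBirationalSubring S := by
  refine ⟨?_, inferInstance⟩
  have hinj : Function.Injective (algebraMap S (FractionRing R)) := by
    rw [IsScalarTower.algebraMap_eq S R (FractionRing R)]
    exact (IsFractionRing.injective R (FractionRing R)).comp Subtype.val_injective
  have : FaithfulSMul S (FractionRing R) := (faithfulSMul_iff_algebraMap_injective _ _).mpr hinj
  refine IsFractionRing.of_field S (FractionRing R) fun z => ?_
  obtain ⟨x, y, hy, rfl⟩ := IsFractionRing.div_surjective (A := R) z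
  obtain ⟨a, ha, ha0, hax⟩ := hfrac x
  obtain ⟨b, hb, hb0, hby⟩ := hfrac y
  have hy0 : algebraMap R (FractionRing R) y ≠ 0 := by
    simpa using nonZeroDivisors.ne_zero hy
  have ha0' : algebraMap R (FractionRing R) a ≠ 0 := by simpa using ha0
  have hb0' : algebraMap R (FractionRing R) b ≠ 0 := by simpa using hb0
  refine ⟨⟨b * (a * x), S.mul_mem hb hax⟩, ⟨a * (b * y), S.mul_mem ha hby⟩, ?_⟩
  rw [IsScalarTower.algebraMap_apply S R (FractionRing R),
    IsScalarTower.algebraMap_apply S R (FractionRing R)]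
  change _ = algebraMap R _ (b * (a * x)) / algebraMap R _ (a * (b * y))
  rw [map_mul, map_mul, map_mul, map_mul]
  field_simp

theorem IsBirationalSubring.exists_smul_eq (hS : IsBirationalSubring S) (r : R) :
    ∃ a : S, a ≠ 0 ∧ ∃ b : S, a • r = algebraMap S R b := by
  have := hS.1
  obtain ⟨⟨b, a⟩, h⟩ := IsLocalization.surj (nonZeroDivisors S) (algebraMap R (FractionRing R) r)
  refine ⟨a, nonZeroDivisors.ne_zero a.2, b, IsFractionRing.injective R (FractionRing R) ?_⟩
  rw [IsScalarTower.algebraMap_apply S R (FractionRing R),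
    IsScalarTower.algebraMap_apply S R (FractionRing R), ← map_mul] at h
  rw [← h, Algebra.smul_def, mul_comm]

end FractionRing

/-! ## Semigroup rings as subrings -/

section Comap

open PowerSeries

variable {K : Type u} [Field K] {H H' : AddSubmonoid ℕ} {R : Type u} [CommRing R]
  [Algebra R (PowerSeries K)]

/-- The elements of `R` with exponents in `H'`. -/
noncomputable def comapSubring (K : Type u) [Field K] (H' : AddSubmonoid ℕ) (R : Type u) [CommRing R]
    [Algebra R (PowerSeries K)] : Subring R :=
  (semigroupRing K H').toSubring.comap (algebraMap R (PowerSeries K))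

theorem mem_comapSubring {r : R} : r ∈ comapSubring K H' R ↔
    ∀ n, n ∉ H' → coeff n (algebraMap R (PowerSeries K) r) = 0 := Iff.rfl

variable [Algebra K R]

namespace IsSemigroupRing

/-- With the structure inherited from `R`, the subring is itself a semigroup ring, so the general
theory applies to it. -/
theorem exists_isSemigroupRing_comapSubring (hR : IsSemigroupRing K H R)
    (hH' : IsNumericalSemigroup H') (hle : H' ≤ H) :
    ∃ (_ : Algebra K (comapSubring K H' R)) (_ : Algebra (comapSubring K H' R) (PowerSeries K)),
      IsScalarTower K (comapSubring K H' R) R ∧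
      IsScalarTower (comapSubring K H' R) R (PowerSeries K) ∧
      IsSemigroupRing K H' (comapSubring K H' R) := by
  have := hR.tower
  have hK : ∀ x : K, algebraMap K R x ∈ comapSubring K H' R := fun x => by
    change algebraMap R (PowerSeries K) (algebraMap K R x) ∈ semigroupRing K H'
    rw [← IsScalarTower.algebraMap_apply]
    exact (semigroupRing K H').algebraMap_mem x
  let i1 : Algebra K (comapSubring K H' R) := ((algebraMap K R).codRestrict _ hK).toAlgebra
  let i2 : Algebra (comapSubring K H' R) (PowerSeries K) :=
    ((algebraMap R (PowerSeries K)).comp (comapSubring K H' R).subtype).toAlgebra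
  refine ⟨i1, i2, IsScalarTower.of_algebraMap_eq' rfl, IsScalarTower.of_algebraMap_eq' rfl, hH',
    IsScalarTower.of_algebraMap_eq fun x => ?_, hR.injective.comp Subtype.val_injective,
    fun f => ⟨?_, fun hf => ?_⟩⟩
  · exact IsScalarTower.algebraMap_apply K R (PowerSeries K) x
  · rintro ⟨r, rfl⟩
    exact r.2
  · obtain ⟨r, hr⟩ := (hR.mem_range_iff f).mpr fun n hn => hf n fun h => hn (hle h)
    exact ⟨⟨r, mem_comapSubring.mpr (hr ▸ hf)⟩, hr⟩

theorem isBirationalSubring_comapSubring (hR : IsSemigroupRing K H R)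
    (hH' : IsNumericalSemigroup H') (hle : H' ≤ H) :
    IsBirationalSubring (comapSubring K H' R) := by
  obtain ⟨_, _, _, _, hS⟩ := hR.exists_isSemigroupRing_comapSubring hH' hle
  have := hR.isDomain
  have := hS.isNoetherian
  have : IsNoetherian (comapSubring K H' R) R := isNoetherian_of_injective
    (IsScalarTower.toAlgHom (comapSubring K H' R) R (PowerSeries K)).toLinearMap hR.injective
  refine isBirationalSubring_of_forall fun r => ?_
  obtain ⟨c, -, hc⟩ := hH'.exists_conductor
  obtain ⟨a, ha⟩ := hR.exists_algebraMap_eq_X_pow (hle (hc c le_rfl))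
  have key : ∀ s f, algebraMap R (PowerSeries K) s = X ^ c * f → s ∈ comapSubring K H' R := by
    intro s f hs
    rw [mem_comapSubring, hs]
    intro n hn
    rw [coeff_X_pow_mul', if_neg fun h => hn (hc n h)]
  refine ⟨a, key a 1 (by rw [ha, mul_one]), ?_, key (a * r) _ (by rw [map_mul, ha])⟩
  rintro rfl
  rw [map_zero] at ha
  exact pow_ne_zero c X_ne_zero ha.symm

theorem isGorensteinRing_comapSubring (hR : IsSemigroupRing K H R) (hle : H' ≤ H) {F : ℕ}
    (hF : ∀ n, F < n → n ∈ H') (hsymm : ∀ i j, i + j = F → (i ∈ H' ↔ j ∉ H')) :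
    IsGorensteinRing (comapSubring K H' R) := by
  obtain ⟨_, _, _, _, hS⟩ :=
    hR.exists_isSemigroupRing_comapSubring (isNumericalSemigroup_of_forall_lt hF) hle
  exact hS.isGorensteinRing hF hsymm

theorem subringColength_comapSubring (hR : IsSemigroupRing K H R)
    (hH' : IsNumericalSemigroup H') (hle : H' ≤ H) {D : Finset ℕ}
    (hD : ∀ n, n ∈ D ↔ n ∈ H ∧ n ∉ H') : subringColength (comapSubring K H' R) = D.card := by
  obtain ⟨_, _, _, _, hS⟩ := hR.exists_isSemigroupRing_comapSubring hH' hle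
  have := hS.isLocalRing
  refine hS.length_quotient_eq_card hR (fun n hn => ((hD n).mp hn).1) fun r => ?_
  have : r ∈ LinearMap.range (Algebra.linearMap (comapSubring K H' R) R) ↔
      r ∈ comapSubring K H' R := ⟨fun ⟨s, hs⟩ => hs ▸ s.2, fun h => ⟨⟨r, h⟩, rfl⟩⟩
  rw [this, mem_comapSubring]
  refine ⟨fun h n hn => h n ((hD n).mp hn).2, fun h n hn => ?_⟩
  by_cases hnH : n ∈ H
  · exact h n ((hD n).mpr ⟨hnH, hn⟩)
  · exact hR.coeff_eq_zero r hnH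

/-! ## The invariants of the family -/

theorem mem_moduleTrace_semigroupH_iff {l : ℕ} (hR : IsSemigroupRing K (semigroupH l) R) {r : R} :
    r ∈ moduleTrace R (canonicalSubmodule K R (12 * l + 19)) ↔
      ∀ n ∈ traceGaps l, coeff n (algebraMap R (PowerSeries K) r) = 0 := by
  constructor
  · intro hr n hn
    refine Submodule.iSup_induction _ hr (motive := fun r =>
      coeff n (algebraMap R (PowerSeries K) r) = 0) ?_ (by simp)
      (fun x y hx hy => by rw [map_add, map_add, hx, hy, add_zero])
    rintro φ _ ⟨f, rfl⟩
    obtain ⟨p, hp, hpφ⟩ := hR.exists_eq_mul_of_linearMap (notMem_semigroupH l) φ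
    have hf := hR.mem_canonicalSubmodule_iff.mp f.2
    rw [hpφ, coeff_mul]
    refine Finset.sum_eq_zero fun ab hab => ?_
    rw [Finset.HasAntidiagonal.mem_antidiagonal] at hab
    by_contra h
    -- Each exponent in the image is one of `R : ω` plus one of `ω`, and no such sum is a trace gap.
    have ha := eq_or_le_of_forall_add_mem fun i hi => hp _ i (left_ne_zero_of_mul h) hi
    have hb := forall_add_ne_iff.mp fun j hj hij => right_ne_zero_of_mul h (hf _ j hij hj)
    rw [mem_traceGaps] at hn
    omega
  · intro h
    set f := algebraMap R (PowerSeries K) r with hfdef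
    -- The part of `r` in degrees `6ℓ+10` to `9ℓ+14`, divided by `t^(6ℓ+10)`; it lies in `ω`, and
    -- what remains of `r` is divisible by `t^(12ℓ+20)`.
    let g : PowerSeries K := PowerSeries.mk fun j =>
      if j ≤ 3 * l + 4 ∧ j % 3 ≠ 2 then coeff (6 * l + 10 + j) f else 0
    have hg : g ∈ canonicalSubmodule K R (12 * l + 19) := by
      rw [hR.mem_canonicalSubmodule_iff]
      intro i j hij hj
      rw [coeff_mk, if_neg]
      exact fun hi => forall_add_ne_iff.mpr (Or.inl hi) j hj hij
    have hp : ∀ n i, coeff n (X ^ (6 * l + 10) : PowerSeries K) ≠ 0 →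
        (∀ j ∈ semigroupH l, i + j ≠ 12 * l + 19) → n + i ∈ semigroupH l := by
      intro n i hn hi
      rw [coeff_X_pow, ne_eq, ite_eq_right_iff, not_forall] at hn
      obtain ⟨rfl, -⟩ := hn
      exact add_mem_semigroupH_of_forall hi
    obtain ⟨r₁, hr₁⟩ := hR.exists_algebraMap_eq_mul hp hg
    have hr₁' := hR.mem_moduleTrace_of_eq_mul hp hg hr₁
    have hdvd : X ^ (12 * l + 20) ∣ algebraMap R (PowerSeries K) (r - r₁) := by
      rw [X_pow_dvd_iff]
      intro n hn
      rw [map_sub, hr₁, map_sub, coeff_X_pow_mul', ← hfdef, sub_eq_zero]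
      split_ifs with hn'
      · rw [coeff_mk, Nat.add_sub_cancel' hn']
        split_ifs with hn''
        · rfl
        · by_cases hnH : n ∈ semigroupH l
          · refine h n (mem_traceGaps.mpr ?_)
            rw [mem_semigroupH_iff] at hnH
            omega
          · exact hR.coeff_eq_zero r hnH
      · by_cases hnH : n ∈ semigroupH l
        · refine h n (mem_traceGaps.mpr ?_)
          rw [mem_semigroupH_iff] at hnH
          omega
        · exact hR.coeff_eq_zero r hnH
    obtain ⟨v, hv⟩ := hdvd
    have h1 : (1 : PowerSeries K) ∈ canonicalSubmodule K R (12 * l + 19) := by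
      rw [← pow_zero X]
      exact hR.X_pow_mem_canonicalSubmodule (forall_add_ne_iff.mpr (by omega))
    -- The remainder lies in `t^(F+1) K[[t]]`, hence multiplies all of `ω` into `R`; it is its own
    -- product with `1 ∈ ω`.
    have h2 := hR.mem_moduleTrace_of_eq_mul (p := algebraMap R (PowerSeries K) (r - r₁)) (f := 1)
      (r := r - r₁) (fun n i hn hi => ?_) h1 (mul_one _).symm
    · simpa using add_mem h2 hr₁'
    · rw [hv, coeff_X_pow_mul', ne_eq, ite_eq_right_iff, not_forall] at hn
      obtain ⟨hn, -⟩ := hn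
      exact mem_semigroupH_of_lt (by omega)

theorem length_quotient_moduleTrace_semigroupH {l : ℕ} (hR : IsSemigroupRing K (semigroupH l) R)
    [IsLocalRing R] {ω : Type u} [AddCommGroup ω] [Module R ω] (hω : IsCanonicalModule R ω) :
    Module.length R (R ⧸ moduleTrace R ω) = 2 * l + 3 := by
  obtain ⟨e⟩ := hR.nonempty_equiv_canonicalSubmodule (notMem_semigroupH l)
    (fun _ => mem_semigroupH_of_lt) hω
  rw [moduleTrace_eq_of_linearEquiv e, hR.length_quotient_eq_card hR
    (fun _ => mem_semigroupH_of_mem_traceGaps) fun r => hR.mem_moduleTrace_semigroupH_iff,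
    card_traceGaps]
  push_cast
  rfl

/-- Otherwise `R` would be a canonical module with trace `R`, of colength `0` instead of `2ℓ+3`. -/
theorem not_isGorensteinRing_semigroupH {l : ℕ} (hR : IsSemigroupRing K (semigroupH l) R) :
    ¬ IsGorensteinRing R := by
  have := hR.isLocalRing
  have := hR.isDomain
  intro h
  have h1 := hR.length_quotient_moduleTrace_semigroupH (hR.isCanonicalModule
    (Algebra.linearMap R (PowerSeries K)) hR.injective (isGorensteinRing_iff_of_isLocalRing.mp h).2)
  rw [moduleTrace_self, Module.length_eq_zero_iff.mpr inferInstance] at h1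
  exact absurd h1.symm (by simp)

theorem birationalGorensteinColength_semigroupH {l : ℕ}
    (hR : IsSemigroupRing K (semigroupH l) R) : birationalGorensteinColength R = l + 2 := by
  have := hR.isLocalRing
  have := hR.isDomain
  refine le_antisymm (sInf_le ⟨comapSubring K (semigroupH' l) R,
    hR.isGorensteinRing_comapSubring (semigroupH'_le l) (fun _ => mem_semigroupH'_of_lt)
      (fun _ _ => mem_semigroupH'_iff_of_add_eq),
    hR.isBirationalSubring_comapSubring (isNumericalSemigroup_of_forall_lt
      fun _ => mem_semigroupH'_of_lt) (semigroupH'_le l), ?_⟩) (le_sInf ?_)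
  · rw [hR.subringColength_comapSubring (isNumericalSemigroup_of_forall_lt
      fun _ => mem_semigroupH'_of_lt) (semigroupH'_le l) fun _ => mem_subringGaps_iff,
      card_subringGaps]
    push_cast
    rfl
  · rintro n ⟨S, hG, hS, rfl⟩
    have := hS.2
    have h1 := hR.length_quotient_moduleTrace_le (notMem_semigroupH l)
      (fun _ => mem_semigroupH_of_lt) (A := S) Subtype.val_injective hS.exists_smul_eq hG
    rw [hR.length_quotient_moduleTrace_semigroupH
      (hR.isCanonicalModule_canonicalSubmodule fun _ => mem_semigroupH_of_lt)] at h1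
    change _ ≤ 2 * subringColength S at h1
    generalize subringColength S = x at h1 ⊢
    -- Parity closes the gap: `2ℓ+3 ≤ 2x` already forces `x ≥ ℓ+2`.
    induction x using ENat.recTopCoe with
    | top => exact le_top
    | coe x =>
      norm_cast at h1 ⊢
      omega

end IsSemigroupRing

end Comap

theorem isSemigroupRing_semigroupRing (K : Type u) [Field K] {H : AddSubmonoid ℕ}
    (hH : IsNumericalSemigroup H) : IsSemigroupRing K H (semigroupRing K H) where
  numerical := hH
  tower := inferInstance
  injective := Subtype.val_injective
  mem_range_iff f := ⟨fun ⟨r, hr⟩ => hr ▸ r.2, fun h => ⟨⟨f, h⟩, rfl⟩⟩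

theorem ENat.two_mul_add_three_eq (l : ℕ) : (2 * l + 3 : ℕ∞) = 2 * (l + 2) - 1 := by
  have h : ((2 * l + 3 : ℕ) : ℕ∞) = ((2 * (l + 2) - 1 : ℕ) : ℕ∞) := by
    congr 1
  rw [ENat.natCast_sub] at h
  push_cast at h
  exact h

theorem ENat.add_two_lt_two_mul_add_three (l : ℕ) : (l + 2 : ℕ∞) < 2 * l + 3 := by
  norm_cast
  omega

theorem mainTheorem4 (K : Type u) [Field K] :
    -- the family of examples
    (∀ l : ℕ,
      IsNumericalSemigroup (semigroupH l) ∧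
      IsCohenMacaulayLocalRing (semigroupRing K (semigroupH l)) ∧
      ringKrullDim (semigroupRing K (semigroupH l)) = 1 ∧
      ¬ IsGorensteinRing (semigroupRing K (semigroupH l)) ∧
      -- `H'` is symmetric, and `K[[H']]` is a birational Gorenstein subring of colength `l + 2`
      IsSymmetricSemigroup (semigroupH' l) ∧
      semigroupH' l ≤ semigroupH l ∧
      IsGorensteinRing (semigroupSubring K (semigroupH' l) (semigroupH l)) ∧
      IsBirationalSubring (semigroupSubring K (semigroupH' l) (semigroupH l)) ∧
      subringColength (semigroupSubring K (semigroupH' l) (semigroupH l)) = l + 2 ∧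
      -- `bg(R) = l + 2`
      birationalGorensteinColength (semigroupRing K (semigroupH l)) = l + 2 ∧
      -- a canonical module exists, and for each one the trace ideal has colength
      -- `2l + 3 = 2 bg(R) - 1 > bg(R)`
      (∃ (ω : Type u) (_ : AddCommGroup ω) (_ : Module (semigroupRing K (semigroupH l)) ω),
        IsCanonicalModule (semigroupRing K (semigroupH l)) ω) ∧
      ∀ (ω : Type u) [AddCommGroup ω] [Module (semigroupRing K (semigroupH l)) ω],
        IsCanonicalModule (semigroupRing K (semigroupH l)) ω →
        Module.length (semigroupRing K (semigroupH l))
          (semigroupRing K (semigroupH l) ⧸ moduleTrace (semigroupRing K (semigroupH l)) ω)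
            = 2 * l + 3 ∧
        Module.length (semigroupRing K (semigroupH l))
          (semigroupRing K (semigroupH l) ⧸ moduleTrace (semigroupRing K (semigroupH l)) ω)
            = 2 * birationalGorensteinColength (semigroupRing K (semigroupH l)) - 1 ∧
        birationalGorensteinColength (semigroupRing K (semigroupH l)) <
          Module.length (semigroupRing K (semigroupH l))
            (semigroupRing K (semigroupH l) ⧸
              moduleTrace (semigroupRing K (semigroupH l)) ω)) ∧
    -- every value `b ≥ 2` of `bg` occurs with `ℓ(R / tr ω) = 2b - 1 > b = bg(R)`
    (∀ b : ℕ, 2 ≤ b → ∃ H : AddSubmonoid ℕ, IsNumericalSemigroup H ∧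
      birationalGorensteinColength (semigroupRing K H) = b ∧
      (∃ (ω : Type u) (_ : AddCommGroup ω) (_ : Module (semigroupRing K H) ω),
        IsCanonicalModule (semigroupRing K H) ω) ∧
      ∀ (ω : Type u) [AddCommGroup ω] [Module (semigroupRing K H) ω],
        IsCanonicalModule (semigroupRing K H) ω →
        Module.length (semigroupRing K H)
          (semigroupRing K H ⧸ moduleTrace (semigroupRing K H) ω) = 2 * (b : ℕ∞) - 1 ∧
        (b : ℕ∞) < Module.length (semigroupRing K H)
          (semigroupRing K H ⧸ moduleTrace (semigroupRing K H) ω)) := by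
  refine ⟨fun l => ?_, fun b hb => ?_⟩
  · have hH := isNumericalSemigroup_of_forall_lt fun _ => mem_semigroupH_of_lt (l := l)
    have hH' := isNumericalSemigroup_of_forall_lt fun _ => mem_semigroupH'_of_lt (l := l)
    have hR := isSemigroupRing_semigroupRing K hH
    have hbg := hR.birationalGorensteinColength_semigroupH
    refine ⟨hH, hR.isCohenMacaulayLocalRing, hR.ringKrullDim_eq_one,
      hR.not_isGorensteinRing_semigroupH,
      isSymmetricSemigroup_of_forall (fun _ => mem_semigroupH'_of_lt)
        (fun _ _ => mem_semigroupH'_iff_of_add_eq), semigroupH'_le l,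
      -- For `R = K[[H]]` with its inclusion into `K[[t]]`, `comapSubring` is `semigroupSubring` by
      -- definition.
      hR.isGorensteinRing_comapSubring (semigroupH'_le l) (fun _ => mem_semigroupH'_of_lt)
        (fun _ _ => mem_semigroupH'_iff_of_add_eq),
      hR.isBirationalSubring_comapSubring hH' (semigroupH'_le l), ?_, hbg,
      ⟨_, _, _, hR.isCanonicalModule_canonicalSubmodule fun _ => mem_semigroupH_of_lt⟩,
      fun ω _ _ hω => ?_⟩
    · refine (hR.subringColength_comapSubring hH' (semigroupH'_le l)
        fun _ => mem_subringGaps_iff).trans ?_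
      rw [card_subringGaps]
      push_cast
      rfl
    · rw [hbg, hR.length_quotient_moduleTrace_semigroupH hω]
      exact ⟨rfl, ENat.two_mul_add_three_eq l, ENat.add_two_lt_two_mul_add_three l⟩
  -- The member `ℓ = b - 2` of the family has `bg(R) = b`.
  · obtain ⟨l, rfl⟩ := Nat.exists_eq_add_of_le' hb
    have hH := isNumericalSemigroup_of_forall_lt fun _ => mem_semigroupH_of_lt (l := l)
    have hR := isSemigroupRing_semigroupRing K hH
    refine ⟨semigroupH l, hH, ?_,
      ⟨_, _, _, hR.isCanonicalModule_canonicalSubmodule fun _ => mem_semigroupH_of_lt⟩,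
      fun ω _ _ hω => ?_⟩
    · rw [hR.birationalGorensteinColength_semigroupH]
      push_cast
      rfl
    · rw [hR.length_quotient_moduleTrace_semigroupH hω]
      push_cast
      exact ⟨ENat.two_mul_add_three_eq l, ENat.add_two_lt_two_mul_add_three l⟩
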